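/- A permutation of size $n\ge 1$ is a bijection $\sigma=\sigma_1\cdots\sigma_n$ of $\{1,\dots,n\}$. A permutation $\pi$ of size $k$ is a pattern of $\sigma$ if $\pi$ is order-isomorphic to $\sigma_{i_1}\cdots\sigma_{i_k}$ for some $i_1<\dots<i_k$. For a set $B$ of permutations, $Av(B)$ is the set of permutations containing no element of $B$ as a pattern. A permutation $\sigma$ of size $n$ is simple if the only sets of consecutive positions $\{i,\dots,j\}$ whose set of values $\{\sigma_i,\dots,\sigma_j\}$ is an interval are the singletons and $\{1,\dots,n\}$. For $m\ge 2$, the exceptional permutations of size $2m$ are $2\,4\cdots(2m)\,1\,3\cdots(2m-1)$ (type 1), $(2m-1)\,(2m-3)\cdots 1\,(2m)\,(2m-2)\cdots 2$ (type 2), $(m+1)\,1\,(m+2)\,2\cdots(2m)\,m$ (type 3), and $m\,(2m)\,(m-1)\,(2m-1)\cdots 1\,(m+1)$ (type 4). Let $B$ be a finite set of simple permutations containing none of $1$, $12$, $21$. Consider the following algorithm with input $B$. 1. Set $Si_1=\{1\}$, $Si_2=\{12,21\}$, $Si_3=\emptyset$, $Si_4=\{2413,3142\}\setminus B$ and $n=5$.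 2. While $Si_{n-1}\neq\emptyset$ or $Si_{n-2}\neq\emptyset$, do: (a) Set $Si_n=\emptyset$. (b) For each $\pi\in Si_{n-1}$ and each way of inserting a point into $\pi$ that gives a simple permutation $\sigma$ (of size $n$): if $\sigma\notin B$, and if each of the $n$ ways of deleting a point of $\sigma$ gives (after renormalization) a permutation that is either not simple or an element of $Si_{n-1}$, then add $\sigma$ to $Si_n$. (c) For each $\pi\in Si_{n-2}$ and each $i$ such that $\pi$ is exceptional of type $i$: if the exceptional permutation $\sigma$ of type $i$ and size $n$ is not in $B$, then add $\sigma$ to $Si_n$. (d) Increase $n$ by $1$. 3. Output the union of all the sets $Si_k$ that were computed, $1\le k<n$. Then the algorithm terminates on input $B$ if and only if $Av(B)$ contains only finitely many simple permutations. Moreover, when it terminates, its output is exactly the set of all simple permutations in $Av(B)$. -/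

import Mathlib

/-- A permutation of size `n`, for any `n`. Positions and values are numbered `0, …, n-1`
instead of `1, …, n`. -/
abbrev Permutation : Type := Σ n : ℕ, Equiv.Perm (Fin n)

namespace Permutation

/-- The size of a permutation. -/
abbrev size (σ : Permutation) : ℕ := σ.1

/-- `π.IsPatternOf σ`: there are positions `i₁ < i₂ < ⋯ < i_k` of `σ` (`k` the size of `π`) such
that `π` is order-isomorphic to the word `σ_{i₁} σ_{i₂} ⋯ σ_{i_k}`. -/
def IsPatternOf (π σ : Permutation) : Prop :=
  ∃ f : Fin π.size → Fin σ.size, StrictMono f ∧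
    ∀ i j : Fin π.size, π.2 i < π.2 j ↔ σ.2 (f i) < σ.2 (f j)

/-- `Av B`: the permutations that contain no element of `B` as a pattern. -/
def Av (B : Set Permutation) : Set Permutation :=
  {σ | ∀ β ∈ B, ¬ β.IsPatternOf σ}

/-- A (non-empty) permutation is simple if every block of consecutive positions `i, …, j` whose
set of values is an interval is a single position or the whole permutation. -/
def IsSimple (σ : Permutation) : Prop :=
  0 < σ.size ∧ ∀ i j : Fin σ.size, i ≤ j →
    (∃ a b : Fin σ.size, (Finset.Icc i j).image σ.2 = Finset.Icc a b) →
      i = j ∨ Finset.Icc i j = Finset.univ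

instance (σ : Permutation) : Decidable σ.IsSimple := by
  unfold IsSimple; infer_instance

/-- The permutation `1`. -/
def p1 : Permutation := ⟨1, Equiv.refl _⟩

/-- The permutation `12`. -/
def p12 : Permutation := ⟨2, Equiv.refl _⟩

/-- The permutation `21`. -/
def p21 : Permutation := ⟨2, Equiv.swap 0 1⟩

/-- The permutation `2413`. -/
def p2413 : Permutation := ⟨4, ⟨![1, 3, 0, 2], ![2, 0, 3, 1], by decide, by decide⟩⟩

/-- The permutation `3142`. -/
def p3142 : Permutation := ⟨4, ⟨![2, 0, 3, 1], ![1, 3, 0, 2], by decide, by decide⟩⟩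

/-- The permutation of size `|π| + 1` obtained by inserting into `π` a new point at position `i`
with value `a`; the positions `≥ i` and the values `≥ a` of `π` are shifted by one. -/
def insertPoint (π : Permutation) (i a : Fin (π.size + 1)) : Permutation :=
  ⟨π.size + 1, ((finSuccEquiv' i).trans (Equiv.optionCongr π.2)).trans (finSuccEquiv' a).symm⟩

/-- The permutation of size `|σ| - 1` obtained by deleting the point at position `i` of `σ`
and renormalizing. -/
def deletePoint : (σ : Permutation) → Fin σ.size → Permutation
  | ⟨0, _⟩, i => i.elim0
  | ⟨n + 1, σ⟩, i =>
      ⟨n, Equiv.removeNone (((finSuccEquiv' i).symm.trans σ).trans (finSuccEquiv' (σ i)))⟩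

/-- The four types of exceptional permutations. -/
inductive ExcType
  | one | two | three | four

/-- The exceptional permutation of size `2 * m` of the given type (for `m ≥ 2`):
* type 1: `2 4 6 ⋯ (2m) 1 3 5 ⋯ (2m-1)`;
* type 2: `(2m-1) (2m-3) ⋯ 1 (2m) (2m-2) ⋯ 2`;
* type 3: `(m+1) 1 (m+2) 2 ⋯ (2m) m`;
* type 4: `m (2m) (m-1) (2m-1) ⋯ 1 (m+1)`.

In the code, positions and values start at `0`. Each permutation is given together with its
inverse; inversion exchanges types 1 and 3, and types 2 and 4. -/
def exceptional (t : ExcType) (m : ℕ) : Permutation :=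
  ⟨2 * m,
    let w1 : Fin (2 * m) → Fin (2 * m) := fun p =>
      ⟨if p.1 < m then 2 * p.1 + 1 else 2 * (p.1 - m), by split_ifs <;> omega⟩
    let w2 : Fin (2 * m) → Fin (2 * m) := fun p =>
      ⟨if p.1 < m then 2 * (m - 1 - p.1) else 2 * (2 * m - 1 - p.1) + 1, by
        split_ifs <;> omega⟩
    let w3 : Fin (2 * m) → Fin (2 * m) := fun p =>
      ⟨if p.1 % 2 = 0 then m + p.1 / 2 else p.1 / 2, by split_ifs <;> omega⟩
    let w4 : Fin (2 * m) → Fin (2 * m) := fun p =>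
      ⟨if p.1 % 2 = 0 then m - 1 - p.1 / 2 else 2 * m - 1 - p.1 / 2, by split_ifs <;> omega⟩
    match t with
    | .one => ⟨w1, w3, by intro p; ext; simp only [w1, w3]; split_ifs <;> omega,
        by intro p; ext; simp only [w1, w3]; split_ifs <;> omega⟩
    | .two => ⟨w2, w4, by intro p; ext; simp only [w2, w4]; split_ifs <;> omega,
        by intro p; ext; simp only [w2, w4]; split_ifs <;> omega⟩
    | .three => ⟨w3, w1, by intro p; ext; simp only [w1, w3]; split_ifs <;> omega,
        by intro p; ext; simp only [w1, w3]; split_ifs <;> omega⟩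
    | .four => ⟨w4, w2, by intro p; ext; simp only [w2, w4]; split_ifs <;> omega,
        by intro p; ext; simp only [w2, w4]; split_ifs <;> omega⟩⟩

end Permutation

/-- Big-step execution of the loop `while guard do body`: `WhileExec guard body s t` says that
the loop, started in state `s`, stops after finitely many iterations, in state `t`. -/
inductive WhileExec {S : Type} (guard : S → Prop) (body : S → S) : S → S → Prop
  | stop_now (s : S) : ¬ guard s → WhileExec guard body s s
  | iterate (s t : S) : guard s → WhileExec guard body (body s) t → WhileExec guard body s t

namespace SimpleGen

open Permutation

/-- The variables of the algorithm: the counter `n` and the sets `Si_0, Si_1, Si_2, …`, each kept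
as a list; the sets not assigned so far are empty. -/
structure State where
  n : ℕ
  Si : ℕ → List Permutation

/-- `Si_1 ← {1}`, `Si_2 ← {12, 21}`, `Si_3 ← ∅`, `Si_4 ← {2413, 3142} \ B`, `n ← 5`. -/
def init (B : Finset Permutation) : State where
  n := 5
  Si k :=
    if k = 1 then [p1]
    else if k = 2 then [p12, p21]
    else if k = 4 then [p2413, p3142].filter (fun σ => σ ∉ B)
    else []

/-- The condition of the while loop: `Si_{n-1} ≠ ∅` or `Si_{n-2} ≠ ∅`. -/
def guard (s : State) : Prop := s.Si (s.n - 1) ≠ [] ∨ s.Si (s.n - 2) ≠ []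

/-- The results of all admissible ways to insert a point into `π` and obtain a simple
permutation. -/
def simpleInsertions (π : Permutation) : List Permutation :=
  ((List.finRange (π.size + 1)).flatMap fun i =>
    (List.finRange (π.size + 1)).map fun a => π.insertPoint i a).filter (fun σ => σ.IsSimple)

/-- The flag `inS`: it is initially true; for each way to delete a point of `σ`, if the resulting
permutation `τ` is simple and `τ ∉ prev`, it is set to false. -/
def deletionTest (prev : List Permutation) (σ : Permutation) : Bool :=
  (List.finRange σ.size).foldl
    (fun inS i =>
      let τ := σ.deletePoint i
      if τ.IsSimple then (if τ ∉ prev then false else inS) else inS)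
    true

/-- First inner loop, with `prev = Si_{n-1}` and current value `acc` of `Si_n`: for each `π` in
`prev` and each admissible insertion giving a simple `σ`, if `σ ∉ B` and the deletion test
succeeds, add `σ`. -/
def insertionLoop (B : Finset Permutation) (prev acc : List Permutation) : List Permutation :=
  prev.foldl
    (fun acc π =>
      (simpleInsertions π).foldl
        (fun acc σ =>
          if σ ∉ B then (if deletionTest prev σ = true then acc.insert σ else acc) else acc)
        acc)
    acc

/-- Second inner loop, with `prev₂ = Si_{n-2}` and current value `acc` of `Si_n`: for each `π` in
`prev₂` and each type `t` such that `π` is exceptional of type `t`, if the exceptional permutation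
`σ` of type `t` and size `|π| + 2` is not in `B`, add `σ`. -/
def exceptionalLoop (B : Finset Permutation) (prev₂ acc : List Permutation) : List Permutation :=
  prev₂.foldl
    (fun acc π =>
      [ExcType.one, ExcType.two, ExcType.three, ExcType.four].foldl
        (fun acc t =>
          let m := π.size / 2
          if 2 ≤ m ∧ π = exceptional t m then
            (let σ := exceptional t (m + 1)
             if σ ∉ B then acc.insert σ else acc)
          else acc)
        acc)
    acc

/-- The body of the while loop: compute `Si_n`, starting from `∅`, then increase `n`. -/
def body (B : Finset Permutation) (s : State) : State where
  n := s.n + 1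
  Si := Function.update s.Si s.n
    (exceptionalLoop B (s.Si (s.n - 2)) (insertionLoop B (s.Si (s.n - 1)) []))

/-- The result in the final state: the union of the computed sets `Si_k`, `k < n`. -/
def result (s : State) : List Permutation := (List.range s.n).flatMap s.Si

/-- On input `B` the algorithm stops and returns `out`. -/
def Returns (B : Finset Permutation) (out : List Permutation) : Prop :=
  ∃ t : State, WhileExec guard (body B) (init B) t ∧ result t = out

/-- On input `B` the algorithm terminates. -/
def Terminates (B : Finset Permutation) : Prop := ∃ out, Returns B out

end SimpleGen

/-! A permutation is a complete digraph on its points, coloured by `col`: each pair records its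
relative order in position and in value. Intervals are the modules of this structure, so a
permutation is simple exactly when it is prime (`isSimple_iff`). The key input is the
Ehrenfeucht–Rozenberg theorem `IsPrimeSet.exists_insert_insert`: a prime subset with at least three
points that misses at least two points can be enlarged by two points and stay prime.

It gives the structure theorem `simple_pattern_cases`. Let β, of size at least 4, be a proper simple
pattern of a simple σ, and let π be a largest proper simple pattern of σ above β. If no simple
one-point deletion of σ contains π, then π misses exactly two points. Neither can be restored alone,
so each sees all of π alike or is a twin of a point of π. They cannot both be of the first kind, and
a pair of twins propagates along σ until σ and π are exceptional of the same type and of consecutive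
sizes.

The loop invariant is that `Si j` consists of the simple permutations of size j in `Av B`.
Soundness: a forbidden pattern of a candidate outside `B` is proper, simple and of size at least 4,
so it lies in a simple one-point deletion, which has been tested, or in the previous exceptional
permutation, which avoids `B`. Completeness: every simple permutation of size at least 3 contains
2413 or 3142 (`IsSimple.p2413_or_p3142`); applied to these patterns, the structure theorem gives
every simple σ of size at least 5 a simple one-point deletion or the previous exceptional
permutation. Sizes thus descend by one or two, so two consecutive empty levels leave nothing above
them. Conversely, if there are finitely many simple permutations in `Av B`, all large levels are
empty and the loop stops. -/

/-! ### Modules and prime subsets of a coloured complete digraph -/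

section Modules

variable {V W C : Type*}

/-- `I` is a module of `X`: the points of `X` outside `I` do not distinguish the points of `I`. -/
def IsModule (c : V → V → C) (X I : Set V) : Prop :=
  ∀ z ∈ X, z ∉ I → ∀ x ∈ I, ∀ y ∈ I, c z x = c z y

/-- `X` is prime if its only modules are the trivial ones. -/
def IsPrimeSet (c : V → V → C) (X : Set V) : Prop :=
  ∀ I ⊆ X, IsModule c X I → I.Subsingleton ∨ I = X

/-- The colour of a pair of distinct points determines the colour of the reversed pair. -/
def Reversible (c : V → V → C) : Prop :=
  ∀ x y z w, x ≠ y → z ≠ w → c x y = c z w → c y x = c w z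

theorem IsPrimeSet.image_iff {c : V → V → C} {c' : W → W → C} {f : W → V}
    (hf : Function.Injective f) (hc : ∀ x y, c' x y = c (f x) (f y)) (X : Set W) :
    IsPrimeSet c (f '' X) ↔ IsPrimeSet c' X := by
  constructor
  · intro h I hI hm
    refine (h (f '' I) (Set.image_mono hI) ?_).elim (fun h => ?_) (fun h => ?_)
    rotate_left
    · left
      intro x hx y hy
      exact hf (h ⟨x, hx, rfl⟩ ⟨y, hy, rfl⟩)
    · right
      exact hf.image_injective h
    · rintro _ ⟨z, hz, rfl⟩ hzI _ ⟨x, hx, rfl⟩ _ ⟨y, hy, rfl⟩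
      rw [← hc, ← hc]
      exact hm z hz (fun h => hzI ⟨z, h, rfl⟩) x hx y hy
  · intro h I hI hm
    obtain ⟨J, hJ, rfl⟩ := Set.subset_image_iff.1 hI
    refine (h J hJ ?_).elim (fun h => ?_) (fun h => ?_)
    rotate_left
    · exact Or.inl (h.image f)
    · exact Or.inr (by rw [h])
    · intro z hz hzJ x hx y hy
      rw [hc, hc]
      refine hm _ ⟨z, hz, rfl⟩ ?_ _ ⟨x, hx, rfl⟩ _ ⟨y, hy, rfl⟩
      rintro ⟨w, hw, hwz⟩
      exact hzJ (hf hwz ▸ hw)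

variable {c : V → V → C} {X : Set V}

/-- A module of a superset of a prime set `X` contains `X` or at most one point of `X`. -/
theorem IsPrimeSet.inter_module (hX : IsPrimeSet c X) {Y J : Set V} (hXY : X ⊆ Y)
    (hJ : IsModule c Y J) : X ⊆ J ∨ (J ∩ X).Subsingleton := by
  refine (hX (J ∩ X) Set.inter_subset_right ?_).elim (fun h => ?_) (fun h => ?_)
  rotate_left
  · exact Or.inr h
  · exact Or.inl (Set.inter_eq_right.1 h)
  · intro z hz hzJ x hx y hy
    exact hJ z (hXY hz) (fun h => hzJ ⟨h, hz⟩) x hx.1 y hy.1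

/-- A one-point extension of a prime set that is not prime: the new point sees all old points
alike, or it is a twin of an old point. -/
theorem IsPrimeSet.insert_cases (hX : IsPrimeSet c X) {v : V}
    (hn : ¬ IsPrimeSet c (insert v X)) :
    (∀ x ∈ X, ∀ y ∈ X, c v x = c v y) ∨
      ∃ u ∈ X, ∀ z ∈ X, z ≠ u → c z u = c z v := by
  unfold IsPrimeSet at hn
  push Not at hn
  obtain ⟨J, hJs, hJ, hJ1, hJ2⟩ := hn
  obtain ⟨x, hx, y, hy, hxy⟩ := hJ1
  rcases hX.inter_module (Set.subset_insert v X) hJ with h | h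
  · left
    intro x hx y hy
    refine hJ v (Set.mem_insert v X) (fun hvJ => hJ2 ?_) x (h hx) y (h hy)
    exact hJs.antisymm (Set.insert_subset hvJ h)
  · right
    have key : ∀ x ∈ J, ∀ y ∈ J, x ≠ y → x = v → ∃ u ∈ X, ∀ z ∈ X, z ≠ u → c z u = c z v := by
      rintro x hx y hy hxy rfl
      have hyX : y ∈ X := (hJs hy).resolve_left (Ne.symm hxy)
      exact ⟨y, hyX, fun z hz hzy => hJ z (Or.inr hz)
        (fun hzJ => hzy (h ⟨hzJ, hz⟩ ⟨hy, hyX⟩)) y hy x hx⟩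
    rcases hJs hx with h1 | h1
    · exact key x hx y hy hxy h1
    · rcases hJs hy with h2 | h2
      · exact key y hy x hx (Ne.symm hxy) h2
      · exact absurd (h ⟨hx, h1⟩ ⟨hy, h2⟩) hxy

/-- The theorem of Ehrenfeucht and Rozenberg: a prime set with at least three points that misses
at least two points of a prime structure has a prime extension by two points. -/
theorem IsPrimeSet.exists_insert_insert (hc : Reversible c) (hV : IsPrimeSet c Set.univ)
    (hX : IsPrimeSet c X) (h3 : ∀ u w, ∃ x ∈ X, x ≠ u ∧ x ≠ w)
    (h2 : ∃ a b, a ∉ X ∧ b ∉ X ∧ a ≠ b) :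
    ∃ a b, a ∉ X ∧ b ∉ X ∧ a ≠ b ∧ IsPrimeSet c (insert a (insert b X)) := by
  by_contra! hcon
  -- the nontrivial modules of the two-point extensions
  have mod : ∀ a b, a ∉ X → b ∉ X → a ≠ b → ∃ J ⊆ insert a (insert b X),
      IsModule c (insert a (insert b X)) J ∧ J.Nontrivial ∧ J ≠ insert a (insert b X) := by
    intro a b ha hb hab
    have := hcon a b ha hb hab
    unfold IsPrimeSet at this
    push Not at this
    exact this
  have sup : ∀ a b J, J ⊆ insert a (insert b X) → IsModule c (insert a (insert b X)) J →
      J ≠ insert a (insert b X) → X ⊆ J →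
      (a ∉ J ∧ ∀ x ∈ J, ∀ y ∈ J, c a x = c a y) ∨ (b ∉ J ∧ ∀ x ∈ J, ∀ y ∈ J, c b x = c b y) := by
    intro a b J hJs hJ hne hXJ
    by_cases haJ : a ∈ J
    · refine Or.inr ⟨?_, ?_⟩
      · exact fun hbJ => hne (hJs.antisymm (Set.insert_subset haJ (Set.insert_subset hbJ hXJ)))
      · exact hJ b (by simp)
          fun hbJ => hne (hJs.antisymm (Set.insert_subset haJ (Set.insert_subset hbJ hXJ)))
    · exact Or.inl ⟨haJ, hJ a (by simp) haJ⟩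
  -- `{u, w}` would be a nontrivial module of `X`, proper by the third point from `h3`. In
  -- `nocorner` the module is `X \ {u}`.
  have notwin : ∀ u w, u ∈ X → w ∈ X → u ≠ w → ¬ ∀ x ∈ X, x ≠ u → x ≠ w → c x u = c x w := by
    intro u w hu hw huw h
    refine (hX {u, w} (by rintro x (rfl | rfl) <;> assumption) ?_).elim (fun h' => ?_) (fun h' => ?_)
    rotate_left
    · exact huw (h' (by simp) (by simp))
    · obtain ⟨x, hx, hxu, hxw⟩ := h3 u w
      rw [← h'] at hx
      rcases hx with rfl | rfl <;> contradiction
    · intro x hx hxn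
      simp only [Set.mem_insert_iff, Set.mem_singleton_iff, not_or] at hxn
      have := h x hx hxn.1 hxn.2
      rintro y (rfl | rfl) z (rfl | rfl) <;> simp_all
  have nocorner : ∀ u ∈ X, ¬ ∀ x ∈ X, x ≠ u → ∀ y ∈ X, y ≠ u → c u x = c u y := by
    intro u hu h
    obtain ⟨x, hx, hxu, -⟩ := h3 u u
    obtain ⟨y, hy, hyu, hyx⟩ := h3 u x
    refine (hX (X \ {u}) Set.sdiff_subset ?_).elim (fun h' => ?_) (fun h' => ?_)
    rotate_left
    · exact hyx (h' ⟨hy, hyu⟩ ⟨hx, hxu⟩)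
    · exact (h'.symm ▸ hu : u ∈ X \ {u}).2 rfl
    · intro z hz hzn x hx y hy
      have : z = u := by by_contra hzu; exact hzn ⟨hz, hzu⟩
      subst this
      exact h x hx.1 hx.2 y hy.1 hy.2
  obtain ⟨x₀, hx₀, -⟩ := h3 h2.choose h2.choose
  -- no point outside sees all of `X` alike
  have hcor : ∀ a, a ∉ X → ¬ ∀ x ∈ X, ∀ y ∈ X, c a x = c a y := by
    intro a₀ ha₀ hcor₀
    -- Points of `K` see `X` alike; by `key` they see all of `Kᶜ` alike. So `Kᶜ`, which contains `X`
    -- and misses `a₀`, is a nontrivial module of the whole structure.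
    set K : Set V := {a | a ∉ X ∧ ∀ x ∈ X, ∀ y ∈ X, c a x = c a y} with hK
    have key : ∀ a ∈ K, ∀ b, b ∉ X → b ∉ K → c a b = c a x₀ := by
      intro a ⟨ha, haX⟩ b hb hbK
      have hab : a ≠ b := by rintro rfl; exact hbK ⟨ha, haX⟩
      have hbX : ¬ ∀ x ∈ X, ∀ y ∈ X, c b x = c b y := fun h => hbK ⟨hb, h⟩
      obtain ⟨J, hJs, hJ, ⟨p, hp, q, hq, hpq⟩, hne⟩ := mod a b ha hb hab
      rcases hX.inter_module (fun x hx => Or.inr (Or.inr hx)) hJ with hXJ | hsub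
      · rcases sup a b J hJs hJ hne hXJ with ⟨haJ, h⟩ | ⟨-, h⟩
        · by_cases hbJ : b ∈ J
          · exact h b hbJ x₀ (hXJ hx₀)
          · exact absurd (fun x hx y hy => hJ b (by simp) hbJ x (hXJ hx) y (hXJ hy)) hbX
        · exact absurd (fun x hx y hy => h x (hXJ hx) y (hXJ hy)) hbX
      · by_cases haJ : a ∈ J
        · exfalso
          by_cases hu : ∃ u ∈ X, u ∈ J
          · obtain ⟨u, hu, huJ⟩ := hu
            apply nocorner u hu
            -- The module property compares colours from `x` towards `u` and `a`; reversibility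
            -- turns them around.
            have h1 : ∀ x ∈ X, x ≠ u → c u x = c a x := by
              intro x hx hxu
              refine hc _ _ _ _ hxu (by rintro rfl; exact ha hx) ?_
              exact hJ x (by simp [hx]) (fun hxJ => hxu (hsub ⟨hxJ, hx⟩ ⟨huJ, hu⟩)) u huJ a haJ
            intro x hx hxu y hy hyu
            rw [h1 x hx hxu, h1 y hy hyu]
            exact haX x hx y hy
          · push Not at hu
            have hbJ : b ∈ J := by
              rcases hJs hp with rfl | rfl | h
              · rcases hJs hq with rfl | rfl | h
                · exact absurd rfl hpq
                · exact hq
                · exact absurd hq (hu _ h)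
              · exact hp
              · exact absurd hp (hu _ h)
            apply hbX
            have h1 : ∀ x ∈ X, c b x = c a x := by
              intro x hx
              refine hc _ _ _ _ (by rintro rfl; exact hb hx) (by rintro rfl; exact ha hx) ?_
              exact hJ x (by simp [hx]) (hu x hx) b hbJ a haJ
            intro x hx y hy
            rw [h1 x hx, h1 y hy]
            exact haX x hx y hy
        · have h0 := hJ a (by simp) haJ
          have hX' : ∀ r ∈ J, r ≠ b → r ∈ X := by
            intro r hr hrb
            rcases hJs hr with rfl | rfl | h
            · exact absurd hr haJ
            · exact absurd rfl hrb
            · exact h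
          by_cases hpb : p = b
          · subst hpb
            rw [h0 p hp q hq]
            exact haX q (hX' q hq (Ne.symm hpq)) x₀ hx₀
          · by_cases hqb : q = b
            · subst hqb
              rw [h0 q hq p hp]
              exact haX p (hX' p hp hpb) x₀ hx₀
            · exact absurd (hsub ⟨hp, hX' p hp hpb⟩ ⟨hq, hX' q hq hqb⟩) hpq
    refine (hV Kᶜ (Set.subset_univ _) ?_).elim (fun h => ?_) (fun h => ?_)
    rotate_left
    · obtain ⟨x, hx, hxx, -⟩ := h3 x₀ x₀
      exact hxx (h (fun h => h.1 hx) (fun h => h.1 hx₀))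
    · have : a₀ ∈ Kᶜ := h.symm ▸ Set.mem_univ a₀
      exact this ⟨ha₀, hcor₀⟩
    · intro z _ hz
      have hz : z ∈ K := by simpa using hz
      have : ∀ x ∈ Kᶜ, c z x = c z x₀ := by
        intro x hx
        by_cases hxX : x ∈ X
        · exact hz.2 x hxX x₀ hx₀
        · exact key z hz x hxX hx
      intro x hx y hy
      rw [this x hx, this y hy]
  -- no point outside is a twin of a point of `X`
  have htwin : ∀ u ∈ X, ∀ a, a ∉ X → ¬ ∀ x ∈ X, x ≠ u → c x u = c x a := by
    intro u hu a₀ ha₀ htw₀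
    -- `K` is the set of outside twins of `u`. The contradiction is that `insert u K` is a module:
    -- it contains `u` and `a₀`, and meets `X` only in `u`.
    set K : Set V := {a | a ∉ X ∧ ∀ x ∈ X, x ≠ u → c x u = c x a} with hK
    have key : ∀ a ∈ K, ∀ z, z ∉ X → z ∉ K → c z u = c z a := by
      intro a ⟨ha, hau⟩ z hz hzK
      have haz : a ≠ z := by rintro rfl; exact hzK ⟨ha, hau⟩
      have hzX : ¬ ∀ x ∈ X, x ≠ u → c x u = c x z := fun h => hzK ⟨hz, h⟩
      obtain ⟨J, hJs, hJ, ⟨p, hp, q, hq, hpq⟩, hne⟩ := mod a z ha hz haz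
      rcases hX.inter_module (fun x hx => Or.inr (Or.inr hx)) hJ with hXJ | hsub
      · rcases sup a z J hJs hJ hne hXJ with ⟨-, h⟩ | ⟨-, h⟩
        · exact absurd (fun x hx y hy => h x (hXJ hx) y (hXJ hy)) (hcor a ha)
        · exact absurd (fun x hx y hy => h x (hXJ hx) y (hXJ hy)) (hcor z hz)
      · by_cases hw : ∃ w ∈ X, w ∈ J
        · obtain ⟨w, hw, hwJ⟩ := hw
          have hout : ∀ x ∈ X, x ≠ w → x ∉ J := fun x hx hxw hxJ =>
            hxw (hsub ⟨hxJ, hx⟩ ⟨hwJ, hw⟩)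
          by_cases haJ : a ∈ J
          · by_cases huw : u = w
            · subst huw
              by_cases hzJ : z ∈ J
              · exact absurd (fun x hx hxu => hJ x (by simp [hx]) (hout x hx hxu) u hwJ z hzJ) hzX
              · exact hJ z (by simp) hzJ u hwJ a haJ
            · exfalso
              refine notwin u w hu hw huw fun x hx hxu hxw => ?_
              rw [hau x hx hxu]
              exact hJ x (by simp [hx]) (hout x hx hxw) a haJ w hwJ
          · have hzJ : z ∈ J := by
              have : ∀ r ∈ J, r = z ∨ r = w := by
                intro r hr
                rcases hJs hr with rfl | rfl | h
                · exact absurd hr haJ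
                · exact Or.inl rfl
                · exact Or.inr (hsub ⟨hr, h⟩ ⟨hwJ, hw⟩)
              rcases this p hp with rfl | rfl
              · exact hp
              · rcases this q hq with rfl | rfl
                · exact hq
                · exact absurd rfl hpq
            have hwu : w ≠ u := by
              rintro rfl
              exact hzX fun x hx hxu => hJ x (by simp [hx]) (hout x hx hxu) w hwJ z hzJ
            have hzw : z ≠ w := by rintro rfl; exact hz hw
            have hzu : z ≠ u := by rintro rfl; exact hz hu
            have haw : a ≠ w := by rintro rfl; exact ha hw
            -- Here `J` is `{z, w}`, so `z` and `w` have equal colours towards `a` and towards `u`;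
            -- the claim for `z` reduces to the twin property of `a` at `w`.
            have e1 : c z a = c w a :=
              hc _ _ _ _ haz haw (hJ a (by simp) haJ z hzJ w hwJ)
            have e2 : c z u = c w u :=
              hc _ _ _ _ (Ne.symm hzu) (Ne.symm hwu)
                (hJ u (by simp [hu]) (hout u hu (Ne.symm hwu)) z hzJ w hwJ)
            rw [e1, e2]
            exact hau w hw hwu
        · exfalso
          push Not at hw
          have hall : ∀ r ∈ J, r = a ∨ r = z := by
            intro r hr
            rcases hJs hr with rfl | rfl | h
            · exact Or.inl rfl
            · exact Or.inr rfl
            · exact absurd hr (hw r h)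
          have : a ∈ J ∧ z ∈ J := by
            rcases hall p hp with rfl | rfl <;> rcases hall q hq with rfl | rfl <;> tauto
          refine hzX fun x hx hxu => ?_
          rw [hau x hx hxu]
          exact hJ x (by simp [hx]) (hw x hx) a this.1 z this.2
    refine (hV (insert u K) (Set.subset_univ _) ?_).elim (fun h => ?_) (fun h => ?_)
    rotate_left
    · have := h (Set.mem_insert u K) (Set.mem_insert_of_mem u (⟨ha₀, htw₀⟩ : a₀ ∈ K))
      exact ha₀ (this ▸ hu)
    · obtain ⟨x, hx, hxu, -⟩ := h3 u u
      have : x ∈ insert u K := h.symm ▸ Set.mem_univ x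
      rcases this with h | h
      · exact hxu h
      · exact h.1 hx
    · intro z _ hz
      have hzu : z ≠ u := fun h => hz (Or.inl h)
      have hzK : z ∉ K := fun h => hz (Or.inr h)
      have : ∀ x ∈ insert u K, c z u = c z x := by
        rintro x (rfl | hx)
        · rfl
        · by_cases hzX : z ∈ X
          · exact hx.2 z hzX hzu
          · exact key x hx z hzX hzK
      intro x hx y hy
      rw [← this x hx, ← this y hy]
  obtain ⟨a, b, ha, hb, hab⟩ := h2
  -- With `hcor` and `htwin` excluded, the module of the two-point extension can only be `{a, b}`.
  -- Hence `X` does not distinguish the outside points, and `Xᶜ` is a nontrivial module.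
  have key : ∀ a b, a ∉ X → b ∉ X → ∀ x ∈ X, c x a = c x b := by
    intro a b ha hb x hx
    by_cases hab : a = b
    · rw [hab]
    obtain ⟨J, hJs, hJ, ⟨p, hp, q, hq, hpq⟩, hne⟩ := mod a b ha hb hab
    rcases hX.inter_module (fun x hx => Or.inr (Or.inr hx)) hJ with hXJ | hsub
    · rcases sup a b J hJs hJ hne hXJ with ⟨-, h⟩ | ⟨-, h⟩
      · exact absurd (fun x hx y hy => h x (hXJ hx) y (hXJ hy)) (hcor a ha)
      · exact absurd (fun x hx y hy => h x (hXJ hx) y (hXJ hy)) (hcor b hb)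
    · have hX' : ∀ w ∈ X, w ∉ J := by
        intro w hw hwJ
        have hout : ∀ x ∈ X, x ≠ w → x ∉ J := fun x hx hxw hxJ =>
          hxw (hsub ⟨hxJ, hx⟩ ⟨hwJ, hw⟩)
        have : ∀ r ∈ J, r = w := by
          intro r hr
          by_contra hrw
          have hrX : r ∉ X := fun hrX => hout r hrX hrw hr
          exact htwin w hw r hrX fun x hx hxw => hJ x (by simp [hx]) (hout x hx hxw) w hwJ r hr
        exact hpq ((this p hp).trans (this q hq).symm)
      have hall : ∀ r ∈ J, r = a ∨ r = b := by
        intro r hr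
        rcases hJs hr with rfl | rfl | h
        · exact Or.inl rfl
        · exact Or.inr rfl
        · exact absurd hr (hX' r h)
      have : a ∈ J ∧ b ∈ J := by
        rcases hall p hp with rfl | rfl <;> rcases hall q hq with rfl | rfl <;> tauto
      exact hJ x (by simp [hx]) (hX' x hx) a this.1 b this.2
  refine (hV Xᶜ (Set.subset_univ _) ?_).elim (fun h => ?_) (fun h => ?_)
  rotate_left
  · exact hab (h ha hb)
  · exact (h.symm ▸ Set.mem_univ x₀ : x₀ ∈ Xᶜ) hx₀
  · intro z _ hz x hx y hy
    exact key x y hx hy z (by simpa using hz)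

end Modules

/-! ### Patterns, embeddings, and simplicity as primality -/

namespace Permutation

/-- The relative order of the positions and of the values of two points. -/
def col (σ : Permutation) (x y : Fin σ.size) : Bool × Bool :=
  (decide (x < y), decide (σ.2 x < σ.2 y))

theorem col_eq_iff {σ τ : Permutation} {x y : Fin σ.size} {z w : Fin τ.size} :
    σ.col x y = τ.col z w ↔ (x < y ↔ z < w) ∧ (σ.2 x < σ.2 y ↔ τ.2 z < τ.2 w) := by
  simp [col]

theorem col_reversible (σ : Permutation) : Reversible σ.col := by
  intro x y z w hxy hzw h
  rw [col_eq_iff] at h ⊢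
  have h1 : σ.2 x ≠ σ.2 y := fun h => hxy (σ.2.injective h)
  have h2 : σ.2 z ≠ σ.2 w := fun h => hzw (σ.2.injective h)
  omega

/-- `f` embeds `π` into `σ`. -/
def IsEmb (π σ : Permutation) (f : Fin π.size → Fin σ.size) : Prop :=
  StrictMono f ∧ ∀ i j : Fin π.size, π.2 i < π.2 j ↔ σ.2 (f i) < σ.2 (f j)

section IsEmb

variable {π σ τ : Permutation} {f : Fin π.size → Fin σ.size}

theorem IsEmb.of_col (h : ∀ i j, π.col i j = σ.col (f i) (f j)) :
    IsEmb π σ f :=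
  ⟨fun i j hij => ((col_eq_iff.1 (h i j)).1).1 hij, fun i j => (col_eq_iff.1 (h i j)).2⟩

theorem IsEmb.col_eq (h : IsEmb π σ f) (i j : Fin π.size) : π.col i j = σ.col (f i) (f j) :=
  col_eq_iff.2 ⟨h.1.lt_iff_lt.symm, h.2 i j⟩

theorem IsEmb.isPrimeSet_iff (h : IsEmb π σ f) :
    IsPrimeSet σ.col (Set.range f) ↔ IsPrimeSet π.col Set.univ := by
  rw [← Set.image_univ]
  exact IsPrimeSet.image_iff h.1.injective h.col_eq _

theorem IsEmb.comp {g : Fin σ.size → Fin τ.size} (hg : IsEmb σ τ g) (hf : IsEmb π σ f) :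
    IsEmb π τ (g ∘ f) :=
  ⟨hg.1.comp hf.1, fun i j => (hf.2 i j).trans (hg.2 _ _)⟩

end IsEmb

theorem IsPatternOf.refl (σ : Permutation) : σ.IsPatternOf σ :=
  ⟨id, strictMono_id, fun _ _ => Iff.rfl⟩

theorem IsPatternOf.trans {π σ τ : Permutation} (h : π.IsPatternOf σ) (h' : σ.IsPatternOf τ) :
    π.IsPatternOf τ := by
  obtain ⟨f, hf⟩ := h
  obtain ⟨g, hg⟩ := h'
  exact ⟨g ∘ f, IsEmb.comp (π := π) (σ := σ) (τ := τ) hg hf⟩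

theorem IsPatternOf.size_le {π σ : Permutation} (h : π.IsPatternOf σ) : π.size ≤ σ.size := by
  obtain ⟨f, hf, -⟩ := h
  simpa using Fintype.card_le_of_injective f hf.injective

theorem strictMono_fin_eq_id {n : ℕ} {f : Fin n → Fin n} (hf : StrictMono f) : f = id := by
  have h := Finite.injective_iff_surjective.1 hf.injective
  let e : Fin n ≃o Fin n := StrictMono.orderIsoOfSurjective f hf h
  have : e = OrderIso.refl _ := Subsingleton.elim _ _
  funext x
  exact DFunLike.congr_fun this x

theorem IsPatternOf.eq_of_size_eq {π σ : Permutation} (h : π.IsPatternOf σ)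
    (hs : π.size = σ.size) : π = σ := by
  obtain ⟨n, p⟩ := π
  obtain ⟨m, q⟩ := σ
  obtain rfl : n = m := hs
  obtain ⟨f, hf, h⟩ := h
  obtain rfl := strictMono_fin_eq_id hf
  have h2 : StrictMono (fun x => q (p.symm x)) := by
    intro x y hxy
    have := (h (p.symm x) (p.symm y)).1 (by simpa using hxy)
    simpa using this
  have h3 := strictMono_fin_eq_id h2
  congr 1
  ext x
  have := congrFun h3 (p x)
  simp at this
  rw [this]

theorem IsPatternOf.size_lt {π σ : Permutation} (h : π.IsPatternOf σ) (hne : π ≠ σ) :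
    π.size < σ.size :=
  lt_of_le_of_ne h.size_le fun hs => hne (h.eq_of_size_eq hs)

/-- Every set of positions carries a pattern. -/
theorem exists_isEmb_range (σ : Permutation) (S : Set (Fin σ.size)) :
    ∃ (π : Permutation) (f : Fin π.size → Fin σ.size), IsEmb π σ f ∧ Set.range f = S := by
  classical
  let s : Finset (Fin σ.size) := S.toFinset
  let t := s.map σ.2.toEmbedding
  have ht : t.card = s.card := Finset.card_map _
  let e1 := s.orderIsoOfFin rfl
  let e2 := t.orderIsoOfFin ht
  let e : s ≃ t := σ.2.subtypeEquiv (by intro a; simp [t])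
  refine ⟨⟨s.card, (e1.toEquiv.trans e).trans e2.symm.toEquiv⟩, fun i => (e1 i).1, ⟨?_, ?_⟩, ?_⟩
  · intro i j hij
    exact e1.strictMono hij
  · intro i j
    have : e2.symm (e (e1 i)) < e2.symm (e (e1 j)) ↔ σ.2 (e1 i) < σ.2 (e1 j) := by
      rw [e2.symm.lt_iff_lt]
      rfl
    exact this
  · ext x
    constructor
    · rintro ⟨i, rfl⟩
      exact Set.mem_toFinset.1 (e1 i).2
    · intro hx
      exact ⟨e1.symm ⟨x, Set.mem_toFinset.2 hx⟩, by simp⟩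

/-- A permutation is simple if and only if the set of its points is prime. -/
theorem isSimple_iff (σ : Permutation) :
    σ.IsSimple ↔ 0 < σ.size ∧ IsPrimeSet σ.col Set.univ := by
  classical
  refine and_congr_right fun _ => ⟨fun h I _ hI => ?_, fun h i j hij ⟨a, b, hab⟩ => ?_⟩
  · by_cases hsub : I.Subsingleton
    · exact Or.inl hsub
    right
    obtain ⟨p, hp, q, hq, hpq⟩ := Set.not_subsingleton_iff.1 hsub
    have hmod : ∀ z, z ∉ I → ∀ x ∈ I, ∀ y ∈ I, (z < x ↔ z < y) ∧ (σ.2 z < σ.2 x ↔ σ.2 z < σ.2 y) :=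
      fun z hz x hx y hy => col_eq_iff.1 (hI z (Set.mem_univ z) hz x hx y hy)
    let s := I.toFinset
    have hs : s.Nonempty := ⟨p, Set.mem_toFinset.2 hp⟩
    let t := s.image σ.2
    have ht : t.Nonempty := hs.image _
    have hmem : ∀ {x}, x ∈ s ↔ x ∈ I := Set.mem_toFinset
    have hmin := hmem.1 (s.min'_mem hs)
    have hmax := hmem.1 (s.max'_mem hs)
    -- A position outside the module but between two of its points would see them differently; `e2`
    -- is the same argument for values.
    have e1 : Finset.Icc (s.min' hs) (s.max' hs) = s := by
      ext z
      rw [Finset.mem_Icc, hmem]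
      constructor
      · rintro ⟨h1, h2⟩
        by_contra hz
        have h3 := (hmod z hz _ hmin _ hmax).1
        have : z ≠ s.max' hs := by intro h; rw [← h] at hmax; exact hz hmax
        omega
      · intro hz
        exact ⟨s.min'_le z (hmem.2 hz), s.le_max' z (hmem.2 hz)⟩
    have e2 : t = Finset.Icc (t.min' ht) (t.max' ht) := by
      obtain ⟨u, hu, hu'⟩ := Finset.mem_image.1 (t.min'_mem ht)
      obtain ⟨v, hv, hv'⟩ := Finset.mem_image.1 (t.max'_mem ht)
      ext y
      rw [Finset.mem_Icc]
      constructor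
      · intro hy
        exact ⟨t.min'_le y hy, t.le_max' y hy⟩
      · rintro ⟨h1, h2⟩
        obtain ⟨z, rfl⟩ := σ.2.surjective y
        by_contra hz
        have hzI : z ∉ I := fun h => hz (Finset.mem_image_of_mem _ (hmem.2 h))
        have h3 := (hmod z hzI u (hmem.1 hu) v (hmem.1 hv)).2
        have : σ.2 z ≠ σ.2 v := fun h => hzI (σ.2.injective h ▸ hmem.1 hv)
        rw [← hu'] at h1
        rw [← hv'] at h2
        omega
    rcases h _ _ (s.min'_le_max' hs) ⟨_, _, (congrArg (Finset.image σ.2) e1).trans e2⟩ with h | h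
    · exfalso
      have h1 := s.min'_le p (hmem.2 hp)
      have h2 := s.le_max' p (hmem.2 hp)
      have h3 := s.min'_le q (hmem.2 hq)
      have h4 := s.le_max' q (hmem.2 hq)
      omega
    · rw [e1] at h
      exact Set.toFinset_eq_univ.1 h
  · have hm : ∀ z, z ∈ Finset.Icc i j ↔ a ≤ σ.2 z ∧ σ.2 z ≤ b := by
      intro z
      rw [← Finset.mem_Icc (a := a), ← hab, Finset.mem_image]
      constructor
      · exact fun h => ⟨z, h, rfl⟩
      · rintro ⟨w, hw, hwz⟩
        exact σ.2.injective hwz ▸ hw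
    have hmod : IsModule σ.col Set.univ (Finset.Icc i j : Set (Fin σ.size)) := by
      intro z _ hz x hx y hy
      rw [Finset.mem_coe] at hz hx hy
      have h1 := (hm x).1 hx
      have h2 := (hm y).1 hy
      have h3 := mt (hm z).2 hz
      rw [Finset.mem_Icc] at hx hy hz
      rw [col_eq_iff]
      omega
    rcases h _ (Set.subset_univ _) hmod with h | h
    · exact Or.inl (h (by simp [hij]) (by simp [hij]))
    · exact Or.inr (Finset.coe_eq_univ.1 h)

theorem IsSimple.isPrimeSet {σ : Permutation} (h : σ.IsSimple) : IsPrimeSet σ.col Set.univ :=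
  ((isSimple_iff σ).1 h).2

/-- The subsets of a simple permutation that look like intervals are trivial. -/
theorem IsSimple.module_trivial {σ : Permutation} (h : σ.IsSimple) (I : Set (Fin σ.size))
    (hI : ∀ z, z ∉ I → ∀ x ∈ I, ∀ y ∈ I, (z < x ↔ z < y) ∧ (σ.2 z < σ.2 x ↔ σ.2 z < σ.2 y)) :
    (∀ x ∈ I, ∀ y ∈ I, x = y) ∨ ∀ x, x ∈ I := by
  rcases h.isPrimeSet I (Set.subset_univ I)
    (fun z _ hz x hx y hy => col_eq_iff.2 (hI z hz x hx y hy)) with h | h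
  · exact Or.inl fun x hx y hy => h hx hy
  · exact Or.inr fun x => h.symm ▸ Set.mem_univ x

theorem IsEmb.isSimple_iff {π σ : Permutation} {f : Fin π.size → Fin σ.size} (h : IsEmb π σ f) :
    π.IsSimple ↔ 0 < π.size ∧ IsPrimeSet σ.col (Set.range f) := by
  rw [h.isPrimeSet_iff, Permutation.isSimple_iff]

/-- The inverse permutation. -/
def inv (σ : Permutation) : Permutation := ⟨σ.size, σ.2.symm⟩

/-- Inversion relabels the points and swaps the two components of every colour; neither affects
which sets are modules. -/
theorem IsSimple.inv {σ : Permutation} (h : σ.IsSimple) : σ.inv.IsSimple := by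
  rw [isSimple_iff] at h ⊢
  refine ⟨h.1, ?_⟩
  have hc : ∀ x y : Fin σ.size,
      σ.inv.col x y = (σ.col (σ.2.symm x) (σ.2.symm y)).swap := by
    intro x y
    change (decide (x < y), decide (σ.2.symm x < σ.2.symm y)) = _
    simp [col]
  refine (IsPrimeSet.image_iff (V := Fin σ.size) (W := Fin σ.size)
    (c := fun x y => (σ.col x y).swap) (c' := σ.inv.col)
    (f := σ.2.symm) σ.2.symm.injective hc Set.univ).1 ?_
  rw [Set.image_univ, Equiv.range_eq_univ]
  intro I hI hm
  refine h.2 I hI fun z hz hzI x hx y hy => ?_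
  exact Prod.swap_injective (hm z hz hzI x hx y hy)

theorem inv_inv (σ : Permutation) : σ.inv.inv = σ := rfl

theorem IsEmb.inv {π σ : Permutation} {f : Fin π.size → Fin σ.size} (h : IsEmb π σ f) :
    IsEmb π.inv σ.inv (fun i => σ.2 (f (π.2.symm i))) := by
  have key : ∀ i j : Fin π.size, (i < j ↔ σ.2 (f (π.2.symm i)) < σ.2 (f (π.2.symm j))) ∧
      (π.2.symm i < π.2.symm j ↔ σ.2.symm (σ.2 (f (π.2.symm i))) <
        σ.2.symm (σ.2 (f (π.2.symm j)))) := by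
    intro i j
    rw [← h.2, σ.2.symm_apply_apply, σ.2.symm_apply_apply, h.1.lt_iff_lt]
    simp
  exact ⟨fun i j hij => (key i j).1.1 hij, fun i j => (key i j).2⟩

theorem IsPatternOf.inv {π σ : Permutation} (h : π.IsPatternOf σ) : π.inv.IsPatternOf σ.inv := by
  obtain ⟨f, hf⟩ := h
  exact ⟨_, IsEmb.inv (π := π) (σ := σ) hf⟩

/-- Deleting a point gives a permutation that embeds onto the remaining points. -/
theorem exists_isEmb_deletePoint (σ : Permutation) (i : Fin σ.size) :
    (σ.deletePoint i).size + 1 = σ.size ∧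
      ∃ f : Fin (σ.deletePoint i).size → Fin σ.size, IsEmb (σ.deletePoint i) σ f ∧
        Set.range f = {i}ᶜ := by
  obtain ⟨n, σ⟩ := σ
  cases n with
  | zero => exact i.elim0
  | succ n =>
    refine ⟨rfl, i.succAbove, ⟨i.strictMono_succAbove, ?_⟩, Fin.range_succAbove i⟩
    -- Deleting `i` renumbers positions through `i.succAbove` and values through `(σ i).succAbove`,
    -- both increasing.
    have key : ∀ j : Fin n, (σ i).succAbove (Equiv.removeNone
        (((finSuccEquiv' i).symm.trans σ).trans (finSuccEquiv' (σ i))) j) = σ (i.succAbove j) := by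
      intro j
      have hne : σ (i.succAbove j) ≠ σ i := fun h => i.succAbove_ne j (σ.injective h)
      obtain ⟨k, hk⟩ := Fin.exists_succAbove_eq hne
      have h1 := Equiv.some_removeNone_iff
        (e := ((finSuccEquiv' i).symm.trans σ).trans (finSuccEquiv' (σ i))) (x := j)
      have h2 : (((finSuccEquiv' i).symm.trans σ).trans (finSuccEquiv' (σ i))) (some j) = some k := by
        simp [← hk]
      have h3 := Equiv.removeNone_some
        (((finSuccEquiv' i).symm.trans σ).trans (finSuccEquiv' (σ i))) ⟨k, h2⟩
      rw [h2, Option.some_inj] at h3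
      rw [h3, hk]
    intro j k
    refine Iff.trans (Fin.strictMono_succAbove (σ i)).lt_iff_lt.symm ?_
    have hj := key j
    have hk := key k
    exact Iff.of_eq (congrArg₂ (· < ·) hj hk)

theorem deletePoint_size (σ : Permutation) (i : Fin σ.size) :
    (σ.deletePoint i).size + 1 = σ.size := (exists_isEmb_deletePoint σ i).1

theorem deletePoint_isPatternOf (σ : Permutation) (i : Fin σ.size) :
    (σ.deletePoint i).IsPatternOf σ := by
  obtain ⟨-, f, hf, -⟩ := exists_isEmb_deletePoint σ i
  exact ⟨f, hf⟩

theorem isSimple_deletePoint_iff (σ : Permutation) (i : Fin σ.size) :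
    (σ.deletePoint i).IsSimple ↔ 2 ≤ σ.size ∧ IsPrimeSet σ.col {i}ᶜ := by
  obtain ⟨hs, f, hf, hr⟩ := exists_isEmb_deletePoint σ i
  rw [hf.isSimple_iff, hr]
  refine and_congr_left fun _ => ?_
  omega

/-- An embedding whose image lies in the image of another one factors through it. -/
theorem IsEmb.isPatternOf {π ρ σ : Permutation} {f : Fin π.size → Fin σ.size}
    {g : Fin ρ.size → Fin σ.size} (hf : IsEmb π σ f) (hg : IsEmb ρ σ g)
    (h : Set.range f ⊆ Set.range g) : π.IsPatternOf ρ := by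
  choose k hk using fun i => h (Set.mem_range_self i)
  refine ⟨k, fun i j hij => ?_, fun i j => ?_⟩
  · rw [← hg.1.lt_iff_lt, hk, hk]
    exact hf.1 hij
  · rw [hg.2, hk, hk]
    exact hf.2 i j

/-- A pattern of size one less is obtained by deleting a point. -/
theorem IsPatternOf.exists_eq_deletePoint {π σ : Permutation} (h : π.IsPatternOf σ)
    (hs : π.size + 1 = σ.size) : ∃ i, π = σ.deletePoint i := by
  obtain ⟨f, hf⟩ := h
  have hf : IsEmb π σ f := hf
  have : ¬ Function.Surjective f := by
    intro hsurj
    have := Fintype.card_le_of_surjective f hsurj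
    simp at this
    omega
  unfold Function.Surjective at this
  push Not at this
  obtain ⟨i, hi⟩ := this
  obtain ⟨hs', g, hg, hr⟩ := exists_isEmb_deletePoint σ i
  refine ⟨i, IsPatternOf.eq_of_size_eq (hf.isPatternOf hg ?_) (by omega)⟩
  rw [hr]
  rintro _ ⟨j, rfl⟩
  exact hi j

/-- Reinserting a deleted point. -/
theorem exists_insertPoint_deletePoint (σ : Permutation) (i : Fin σ.size) :
    ∃ j a, (σ.deletePoint i).insertPoint j a = σ := by
  obtain ⟨n, σ⟩ := σ
  cases n with
  | zero => exact i.elim0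
  | succ n =>
    refine ⟨i, σ i, ?_⟩
    let e := ((finSuccEquiv' i).symm.trans σ).trans (finSuccEquiv' (σ i))
    have he : Equiv.optionCongr (Equiv.removeNone e) = e := by
      have h0 : e none = none := by simp [e]
      ext1 x
      cases x with
      | none => exact h0.symm
      | some x =>
        refine Equiv.removeNone_some e (Option.ne_none_iff_exists'.1 fun h => ?_)
        exact Option.some_ne_none x (e.injective (h.trans h0.symm))
    have : ((finSuccEquiv' i).trans (Equiv.optionCongr (Equiv.removeNone e))).trans
        (finSuccEquiv' (σ i)).symm = σ := by
      rw [he]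
      ext x
      simp [e]
    exact congrArg (Sigma.mk (n + 1)) this

end Permutation

/-! ### Occurrences of 2413 and 3142 -/

namespace Permutation

theorem p2413_isPatternOf {σ : Permutation} {a b c d : Fin σ.size} (h1 : a < b) (h2 : b < c)
    (h3 : c < d) (h4 : σ.2 c < σ.2 a) (h5 : σ.2 a < σ.2 d) (h6 : σ.2 d < σ.2 b) :
    p2413.IsPatternOf σ := by
  have hf : StrictMono ![a, b, c, d] := Fin.strictMono_iff_lt_succ.2 (by
    intro i
    fin_cases i <;> [exact h1; exact h2; exact h3])
  have hg : StrictMono ![σ.2 c, σ.2 a, σ.2 d, σ.2 b] := Fin.strictMono_iff_lt_succ.2 (by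
    intro i
    fin_cases i <;> [exact h4; exact h5; exact h6])
  have key : ∀ i : Fin 4, σ.2 (![a, b, c, d] i) = ![σ.2 c, σ.2 a, σ.2 d, σ.2 b] (p2413.2 i) := by
    intro i
    fin_cases i <;> rfl
  refine ⟨![a, b, c, d], hf, fun i j => ?_⟩
  rw [key i, key j]
  exact hg.lt_iff_lt.symm

theorem p3142_isPatternOf {σ : Permutation} {a b c d : Fin σ.size} (h1 : a < b) (h2 : b < c)
    (h3 : c < d) (h4 : σ.2 b < σ.2 d) (h5 : σ.2 d < σ.2 a) (h6 : σ.2 a < σ.2 c) :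
    p3142.IsPatternOf σ := by
  have hf : StrictMono ![a, b, c, d] := Fin.strictMono_iff_lt_succ.2 (by
    intro i
    fin_cases i <;> [exact h1; exact h2; exact h3])
  have hg : StrictMono ![σ.2 b, σ.2 d, σ.2 a, σ.2 c] := Fin.strictMono_iff_lt_succ.2 (by
    intro i
    fin_cases i <;> [exact h4; exact h5; exact h6])
  have key : ∀ i : Fin 4, σ.2 (![a, b, c, d] i) = ![σ.2 b, σ.2 d, σ.2 a, σ.2 c] (p3142.2 i) := by
    intro i
    fin_cases i <;> rfl
  refine ⟨![a, b, c, d], hf, fun i j => ?_⟩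
  rw [key i, key j]
  exact hg.lt_iff_lt.symm

/-- A word of length at least three with trivial modules and an initial descent contains `3142`. -/
theorem exists_3142_of_descent {n : ℕ} (hn : 3 ≤ n) (v : Fin n → ℤ) (hv : Function.Injective v)
    (h : ∀ I : Set (Fin n), (∀ z, z ∉ I → ∀ x ∈ I, ∀ y ∈ I, (z < x ↔ z < y) ∧ (v z < v x ↔ v z < v y)) →
      (∀ x ∈ I, ∀ y ∈ I, x = y) ∨ ∀ x, x ∈ I)
    (h10 : v ⟨1, by omega⟩ < v ⟨0, by omega⟩) :
    ∃ a b c d : Fin n, a < b ∧ b < c ∧ c < d ∧ v b < v d ∧ v d < v a ∧ v a < v c := by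
  set a : Fin n := ⟨0, by omega⟩ with ha
  -- Otherwise the first letter is the maximum and all other positions form a nontrivial module.
  have hex : ∃ x, v a < v x := by
    by_contra! hcon
    refine (h {a}ᶜ ?_).elim (fun h => ?_) (fun h => ?_)
    rotate_left
    · have := h ⟨1, by omega⟩ (by simp [ha]) ⟨2, by omega⟩ (by simp [ha])
      simp at this
    · exact h a rfl
    · intro z hz x hx y hy
      have hz : z = a := by simpa using hz
      subst hz
      have h1 : (0 : ℕ) ≠ x.1 := fun h => hx (Fin.ext h.symm)
      have h2 : (0 : ℕ) ≠ y.1 := fun h => hy (Fin.ext h.symm)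
      have := hcon x
      have := hcon y
      refine ⟨?_, by omega⟩
      rw [Fin.lt_def, Fin.lt_def]
      simp only [ha]
      omega
  -- `c` is the first position whose letter exceeds the initial one. The prefix before `c` has at
  -- least two points and is not a module, so some letter after `c` lies between the initial letter,
  -- which is the maximum of the prefix, and another prefix letter. This is the 3142.
  obtain ⟨c, hc, hcmin⟩ := WellFounded.has_min (wellFounded_lt (α := Fin n)) {x | v a < v x} hex
  have hcmin : ∀ x, x < c → v x ≤ v a := fun x hx => not_lt.1 fun h => hcmin x h hx
  have hc : v a < v c := hc
  have hc1 : 1 < c.1 := by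
    rcases Nat.lt_or_ge 1 c.1 with h | h
    · exact h
    · exfalso
      have : c = a ∨ c = ⟨1, by omega⟩ := by
        rw [Fin.ext_iff, Fin.ext_iff]
        simp only [ha]
        omega
      rcases this with h | h <;> rw [h] at hc <;> omega
  by_contra! hcon
  refine (h {x | x < c} ?_).elim (fun h => ?_) (fun h => ?_)
  rotate_left
  · have h01 := h a (by rw [Set.mem_ofPred, Fin.lt_def]; simp only [ha]; omega) ⟨1, by omega⟩ hc1
    simp [ha] at h01
  · exact lt_irrefl c (h c)
  · intro z hz x hx y hy
    have hz : c ≤ z := not_lt.1 hz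
    have hx : x < c := hx
    have hy : y < c := hy
    refine ⟨by omega, ?_⟩
    have key : ∀ x, x < c → (v z < v x ↔ v z < v a) := by
      intro x hx
      have hxa := hcmin x hx
      refine ⟨fun h => by omega, fun hza => ?_⟩
      have hzc : z ≠ c := by rintro rfl; omega
      by_cases hxa' : x = a
      · rw [hxa']; exact hza
      have hax : a < x := by
        rw [Fin.lt_def]
        have : x.1 ≠ 0 := fun h => hxa' (Fin.ext h)
        simp only [ha]
        omega
      have hne : v x ≠ v z := fun h => by have := hv h; omega
      have := hcon a x c z hax hx (by omega)
      by_contra hlt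
      have := this (by omega) hza
      omega
    rw [key x hx, key y hy]

/-- Every simple permutation of size at least three contains `2413` or `3142`. -/
theorem IsSimple.p2413_or_p3142 {σ : Permutation} (h : σ.IsSimple) (h3 : 3 ≤ σ.size) :
    p2413.IsPatternOf σ ∨ p3142.IsPatternOf σ := by
  have hne : σ.2 (⟨1, by omega⟩ : Fin σ.size) ≠ σ.2 (⟨0, by omega⟩ : Fin σ.size) := fun h => by simpa using σ.2.injective h
  rcases lt_or_gt_of_ne hne with hlt | hlt
  · obtain ⟨a, b, c, d, h1, h2, h3, h4, h5, h6⟩ := exists_3142_of_descent h3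
      (fun x => ((σ.2 x : ℕ) : ℤ)) (fun x y hxy => σ.2.injective (Fin.ext (by simpa using hxy)))
      (fun I hI => h.module_trivial I fun z hz x hx y hy => by
        have := hI z hz x hx y hy
        exact ⟨this.1, by simpa using this.2⟩) (by simpa using hlt)
    exact Or.inr (p3142_isPatternOf h1 h2 h3 (by simpa using h4) (by simpa using h5)
      (by simpa using h6))
  -- Negating the values turns the initial ascent into a descent and 3142 into 2413; hence the
  -- integer-valued words.
  · obtain ⟨a, b, c, d, h1, h2, h3, h4, h5, h6⟩ := exists_3142_of_descent h3
      (fun x => -((σ.2 x : ℕ) : ℤ)) (fun x y hxy => σ.2.injective (Fin.ext (by simpa using hxy)))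
      (fun I hI => h.module_trivial I fun z hz x hx y hy => by
        have := hI z hz x hx y hy
        refine ⟨this.1, ?_⟩
        have h1 : σ.2 z ≠ σ.2 x := fun h => hz (σ.2.injective h ▸ hx)
        have h2 : σ.2 z ≠ σ.2 y := fun h => hz (σ.2.injective h ▸ hy)
        have := this.2
        omega) (by simpa using hlt)
    exact Or.inl (p2413_isPatternOf h1 h2 h3 (by simpa using h6) (by simpa using h5)
      (by simpa using h4))

/-! ### Exceptional permutations -/

theorem exceptional_three_val (m : ℕ) (p : Fin (exceptional .three m).size) :
    ((exceptional .three m).2 p).1 = if p.1 % 2 = 0 then m + p.1 / 2 else p.1 / 2 := rfl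

theorem exceptional_four_val (m : ℕ) (p : Fin (exceptional .four m).size) :
    ((exceptional .four m).2 p).1 =
      if p.1 % 2 = 0 then m - 1 - p.1 / 2 else 2 * m - 1 - p.1 / 2 := rfl

/-- An interval with at least two points contains two neighbouring positions, which have different
parity. By `h` its values then include those at both end positions, so it is everything. -/
theorem isSimple_of_alternating {m : ℕ} {σ : Equiv.Perm (Fin (2 * m))} (hm : 2 ≤ m)
    (h : ∀ p q : Fin (2 * m), p.1 % 2 ≠ q.1 % 2 → ∃ a b : Fin (2 * m), a.1 = 0 ∧ b.1 = 2 * m - 1 ∧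
      (σ p ≤ σ a ∧ σ a ≤ σ q ∨ σ q ≤ σ a ∧ σ a ≤ σ p) ∧
      (σ p ≤ σ b ∧ σ b ≤ σ q ∨ σ q ≤ σ b ∧ σ b ≤ σ p)) :
    IsSimple ⟨2 * m, σ⟩ := by
  suffices key : ∀ i j : Fin (2 * m), i ≤ j →
      (∃ a b : Fin (2 * m), (Finset.Icc i j).image σ = Finset.Icc a b) →
      i = j ∨ Finset.Icc i j = Finset.univ from ⟨by change 0 < 2 * m; omega, key⟩
  rintro i j hij ⟨a, b, hab⟩
  by_cases hlt : i = j
  · exact Or.inl hlt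
  right
  have hm : ∀ z, z ∈ Finset.Icc i j ↔ a ≤ σ z ∧ σ z ≤ b := by
    intro z
    rw [← Finset.mem_Icc (a := a), ← hab, Finset.mem_image]
    constructor
    · exact fun h => ⟨z, h, rfl⟩
    · rintro ⟨w, hw, hwz⟩
      exact σ.injective hwz ▸ hw
  let i' : Fin (2 * m) := ⟨i.1 + 1, by omega⟩
  have h1 := (hm i).1 (Finset.mem_Icc.2 ⟨le_rfl, hij⟩)
  have h2 := (hm i').1 (Finset.mem_Icc.2 ⟨by rw [Fin.le_def]; simp [i'],
    by rw [Fin.le_def]; simp only [i']; omega⟩)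
  obtain ⟨x, y, hx, hy, hx', hy'⟩ := h i i' (by simp only [i']; omega)
  have h3 := Finset.mem_Icc.1 ((hm x).2 (by omega))
  have h4 := Finset.mem_Icc.1 ((hm y).2 (by omega))
  ext z
  rw [Finset.mem_Icc]
  simp only [Finset.mem_univ, iff_true]
  omega

/-- In types 3 and 4 the even and odd positions carry opposite halves of the values, and the end
positions carry the two middle values. Types 1 and 2 follow by inversion. -/
theorem isSimple_exceptional {m : ℕ} (hm : 2 ≤ m) (t : ExcType) : (exceptional t m).IsSimple := by
  have h3 : (exceptional .three m).IsSimple := by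
    refine isSimple_of_alternating (σ := (exceptional .three m).2) hm fun p q hpq =>
      ⟨⟨0, by omega⟩, ⟨2 * m - 1, by omega⟩, rfl, rfl, ?_⟩
    have hp := p.2
    have hq := q.2
    have v1 := exceptional_three_val m p
    have v2 := exceptional_three_val m q
    have v3 := exceptional_three_val m (⟨0, by omega⟩ : Fin (2 * m))
    have v4 := exceptional_three_val m (⟨2 * m - 1, by omega⟩ : Fin (2 * m))
    rw [if_pos (by norm_num)] at v3
    rw [if_neg (by simp only; omega)] at v4
    simp only at v3 v4
    simp only [Fin.le_def]
    split_ifs at v1 v2 <;> omega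
  have h4 : (exceptional .four m).IsSimple := by
    refine isSimple_of_alternating (σ := (exceptional .four m).2) hm fun p q hpq =>
      ⟨⟨0, by omega⟩, ⟨2 * m - 1, by omega⟩, rfl, rfl, ?_⟩
    have hp := p.2
    have hq := q.2
    have v1 := exceptional_four_val m p
    have v2 := exceptional_four_val m q
    have v3 := exceptional_four_val m (⟨0, by omega⟩ : Fin (2 * m))
    have v4 := exceptional_four_val m (⟨2 * m - 1, by omega⟩ : Fin (2 * m))
    rw [if_pos (by norm_num)] at v3
    rw [if_neg (by simp only; omega)] at v4
    simp only at v3 v4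
    simp only [Fin.le_def]
    split_ifs at v1 v2 <;> omega
  cases t with
  | one => exact h3.inv
  | two => exact h4.inv
  | three => exact h3
  | four => exact h4

theorem exists_ne_of_four_le {n : ℕ} (hn : 4 ≤ n) (i e : Fin n) :
    ∃ x y : Fin n, x ≠ y ∧ x ≠ i ∧ x ≠ e ∧ y ≠ i ∧ y ≠ e := by
  have : 1 < ({i, e}ᶜ : Finset (Fin n)).card := by
    rw [Finset.card_compl, Fintype.card_fin]
    have := Finset.card_le_two (a := i) (b := e)
    omega
  obtain ⟨x, hx, y, hy, hxy⟩ := Finset.one_lt_card.1 this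
  simp at hx hy
  exact ⟨x, y, hxy, hx.1, hx.2, hy.1, hy.2⟩

/-- A permutation whose first and last points are attached to a path of twins
has no simple one-point deletion. -/
theorem not_isSimple_deletePoint_of_twins {σ : Permutation} (hn : 5 ≤ σ.size)
    (hE : ∀ i j : Fin σ.size, i.1 + 2 = j.1 →
      (σ.2 i).1 + 1 = (σ.2 j).1 ∨ (σ.2 j).1 + 1 = (σ.2 i).1)
    (h0 : ∀ j : Fin σ.size, j.1 = 1 → (σ.2 j).1 = 0 ∨ (σ.2 j).1 + 1 = σ.size)
    (h1 : ∀ j : Fin σ.size, j.1 + 2 = σ.size → (σ.2 j).1 = 0 ∨ (σ.2 j).1 + 1 = σ.size)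
    (i : Fin σ.size) : ¬ (σ.deletePoint i).IsSimple := by
  rw [isSimple_deletePoint_iff]
  rintro ⟨-, h⟩
  -- Without `i` the point `e` occupies a corner, and the remaining points form a nontrivial module.
  have end_case : ∀ e : Fin σ.size, e ≠ i → (σ.2 e).1 = 0 ∨ (σ.2 e).1 + 1 = σ.size →
      (∀ x, x ≠ i → x ≠ e → e < x) ∨ (∀ x, x ≠ i → x ≠ e → x < e) → False := by
    intro e hei hv hp
    refine (h ({i, e}ᶜ) (by intro x hx; simp at hx ⊢; exact hx.1) ?_).elim (fun h => ?_) (fun h => ?_)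
    rotate_left
    · obtain ⟨x, y, hxy, h1, h2, h3, h4⟩ := exists_ne_of_four_le (by omega) i e
      exact hxy (h (by simp [h1, h2]) (by simp [h3, h4]))
    · have : e ∈ ({i, e}ᶜ : Set (Fin σ.size)) := h.symm ▸ (by simpa using hei)
      simp at this
    · intro z hz hz' x hx y hy
      simp at hz hz' hx hy
      obtain rfl := hz' hz
      rw [col_eq_iff]
      have e1 : (σ.2 x).1 ≠ σ.2 z := fun h => hx.2 (σ.2.injective (Fin.ext h))
      have e2 : (σ.2 y).1 ≠ σ.2 z := fun h => hy.2 (σ.2.injective (Fin.ext h))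
      have e3 := (σ.2 x).2
      have e4 := (σ.2 y).2
      constructor
      · rcases hp with hp | hp
        · simp [hp x hx.1 hx.2, hp y hy.1 hy.2]
        · simp [(hp x hx.1 hx.2).not_gt, (hp y hy.1 hy.2).not_gt]
      · rw [Fin.lt_def, Fin.lt_def]
        change (σ.2 x).1 < σ.size at e3
        change (σ.2 y).1 < σ.size at e4
        omega
  have hs : σ.size = σ.1 := rfl
  rcases Nat.eq_zero_or_pos i.1 with hi | hi
  · refine end_case ⟨1, by omega⟩ (fun h => ?_) (h0 _ rfl) (Or.inl fun x hx hx' => ?_)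
    · rw [← h] at hi
      simp at hi
    · have e1 : x.1 ≠ i.1 := fun h => hx (Fin.ext h)
      have e2 : x.1 ≠ 1 := fun h => hx' (Fin.ext h)
      rw [Fin.lt_def]
      simp only
      omega
  by_cases hi' : i.1 + 1 = σ.size
  · refine end_case ⟨σ.size - 2, by omega⟩ (fun h => ?_) (h1 _ (by simp only; omega))
      (Or.inr fun x hx hx' => ?_)
    · rw [← h] at hi'
      simp only at hi'
      omega
    · have e1 : x.1 ≠ i.1 := fun h => hx (Fin.ext h)
      have e2 : x.1 ≠ σ.size - 2 := fun h => hx' (Fin.ext h)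
      rw [Fin.lt_def]
      simp only
      omega
  · set a : Fin σ.size := ⟨i.1 - 1, by omega⟩ with ha
    set b : Fin σ.size := ⟨i.1 + 1, by omega⟩ with hb
    have hab : a ≠ b := by
      rw [Ne, Fin.ext_iff]
      simp only [ha, hb]
      omega
    have hai : a ≠ i := by
      rw [Ne, Fin.ext_iff]
      simp only [ha]
      omega
    have hbi : b ≠ i := by
      rw [Ne, Fin.ext_iff]
      simp only [hb]
      omega
    have hE' := hE a b (by simp only [ha, hb]; omega)
    -- `a` and `b` are adjacent in value, and removing `i` makes them adjacent in position.
    have hmod : IsModule σ.col {i}ᶜ {a, b} := by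
      intro z hz hz'
      have key : σ.col z a = σ.col z b := by
        simp only [Set.mem_compl_iff, Set.mem_singleton_iff, Set.mem_insert_iff, not_or] at hz hz'
        have e1 : (σ.2 z).1 ≠ σ.2 a := fun h => hz'.1 (σ.2.injective (Fin.ext h))
        have e2 : (σ.2 z).1 ≠ σ.2 b := fun h => hz'.2 (σ.2.injective (Fin.ext h))
        have e3 : z.1 ≠ i.1 := fun h => hz (Fin.ext h)
        have e4 : z.1 ≠ a.1 := fun h => hz'.1 (Fin.ext h)
        have e5 : z.1 ≠ b.1 := fun h => hz'.2 (Fin.ext h)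
        simp only [ha, hb] at e4 e5
        rw [col_eq_iff, Fin.lt_def, Fin.lt_def, Fin.lt_def, Fin.lt_def]
        refine ⟨?_, by omega⟩
        simp only [ha, hb]
        omega
      rintro x (rfl | rfl) y (rfl | rfl)
      · rfl
      · exact key
      · exact key.symm
      · rfl
    rcases h {a, b} (by rintro x (rfl | rfl) <;> simpa) hmod with h | h
    · exact hab (h (by simp) (by simp))
    · obtain ⟨x, y, hxy, h1, h2, h3, h4⟩ := exists_ne_of_four_le (by omega) a b
      have hx : x = i := by
        by_contra hx
        have : x ∈ ({a, b} : Set _) := h ▸ hx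
        rcases this with rfl | rfl <;> contradiction
      have hy : y = i := by
        by_contra hx
        have : y ∈ ({a, b} : Set _) := h ▸ hx
        rcases this with rfl | rfl <;> contradiction
      exact hxy (hx.trans hy.symm)

theorem not_isSimple_deletePoint_of_inv {σ : Permutation}
    (h : ∀ i, ¬ (σ.inv.deletePoint i).IsSimple) (i : Fin σ.size) :
    ¬ (σ.deletePoint i).IsSimple := by
  intro hs
  have h1 := (deletePoint_isPatternOf σ i).inv
  obtain ⟨j, hj⟩ := h1.exists_eq_deletePoint (deletePoint_size σ i)
  exact h j (hj ▸ hs.inv)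

/-- Types 3 and 4 have their extreme values in the second and second-to-last positions. Insertion
into a simple permutation can therefore never produce these permutations, which is why the algorithm
has a separate exceptional loop. -/
theorem not_isSimple_deletePoint_exceptional {m : ℕ} (hm : 3 ≤ m) (t : ExcType)
    (i : Fin (exceptional t m).size) : ¬ ((exceptional t m).deletePoint i).IsSimple := by
  have h3 : ∀ i, ¬ ((exceptional .three m).deletePoint i).IsSimple := by
    have hs : (exceptional .three m).size = 2 * m := rfl
    refine not_isSimple_deletePoint_of_twins (by omega) ?_ ?_ ?_
    · intro i j hij
      rw [exceptional_three_val, exceptional_three_val]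
      split_ifs <;> omega
    · intro j hj
      rw [exceptional_three_val]
      split_ifs <;> omega
    · intro j hj
      rw [exceptional_three_val]
      split_ifs <;> omega
  have h4 : ∀ i, ¬ ((exceptional .four m).deletePoint i).IsSimple := by
    have hs : (exceptional .four m).size = 2 * m := rfl
    refine not_isSimple_deletePoint_of_twins (by omega) ?_ ?_ ?_
    · intro i j hij
      have := j.2
      rw [exceptional_four_val, exceptional_four_val]
      split_ifs <;> omega
    · intro j hj
      rw [exceptional_four_val]
      split_ifs <;> omega
    · intro j hj
      rw [exceptional_four_val]
      split_ifs <;> omega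
  cases t with
  | one => exact not_isSimple_deletePoint_of_inv (σ := exceptional .one m) h3 i
  | two => exact not_isSimple_deletePoint_of_inv (σ := exceptional .two m) h4 i
  | three => exact h3 i
  | four => exact h4 i

end Permutation

/-! ### Corners and twins after removing two points -/

namespace Permutation

/-- `π` embeds into `σ` onto the complement of the points `a` and `b`. -/
def CopyOff (π σ : Permutation) (a b : Fin σ.size) : Prop :=
  ∃ f, IsEmb π σ f ∧ Set.range f = {a, b}ᶜ

theorem CopyOff.symm {π σ : Permutation} {a b : Fin σ.size} (h : CopyOff π σ a b) :
    CopyOff π σ b a := by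
  rw [CopyOff, Set.pair_comm]
  exact h

theorem CopyOff.isPatternOf_deletePoint {π σ : Permutation} {a b : Fin σ.size}
    (h : CopyOff π σ a b) : π.IsPatternOf (σ.deletePoint a) := by
  obtain ⟨f, hf, hr⟩ := h
  obtain ⟨-, g, hg, hr'⟩ := exists_isEmb_deletePoint σ a
  refine hf.isPatternOf hg ?_
  rw [hr, hr']
  intro x hx
  simp at hx ⊢
  exact hx.1

theorem CopyOff.inv {π σ : Permutation} {a b : Fin σ.size} (h : CopyOff π σ a b) :
    CopyOff π.inv σ.inv (σ.2 a) (σ.2 b) := by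
  obtain ⟨f, hf, hr⟩ := h
  refine ⟨_, hf.inv, ?_⟩
  have : Set.range (fun i => σ.2 (f (π.2.symm i))) = σ.2 '' (Set.range f) := by
    ext x
    constructor
    · rintro ⟨i, rfl⟩
      exact ⟨_, ⟨_, rfl⟩, rfl⟩
    · rintro ⟨_, ⟨i, rfl⟩, rfl⟩
      exact ⟨π.2 i, by simp⟩
  refine this.trans ?_
  rw [hr, Set.image_compl_eq σ.2.bijective, Set.image_pair]
  rfl

/-- The point `d` sees all points other than `c` and `d` alike, or it has a twin `u`, for which
it can be exchanged. -/
theorem CopyOff.corner_or_twin {π σ : Permutation} {c d : Fin σ.size} (h : CopyOff π σ c d)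
    (hcd : c ≠ d) (hπ : π.IsSimple) (hn : ¬ (σ.deletePoint c).IsSimple) :
    (∀ x, x ≠ c → x ≠ d → ∀ y, y ≠ c → y ≠ d → σ.col d x = σ.col d y) ∨
      ∃ u, u ≠ c ∧ u ≠ d ∧ (∀ z, z ≠ u → z ≠ c → z ≠ d → σ.col z u = σ.col z d) ∧
        CopyOff π σ c u := by
  obtain ⟨f, hf, hr⟩ := h
  have hX : IsPrimeSet σ.col {c, d}ᶜ := hr ▸ (hf.isSimple_iff.1 hπ).2
  have hmem : ∀ x, x ∈ ({c, d}ᶜ : Set (Fin σ.size)) ↔ x ≠ c ∧ x ≠ d := by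
    intro x
    simp
  have hins : insert d ({c, d}ᶜ : Set (Fin σ.size)) = {c}ᶜ := by
    ext x
    simp only [Set.mem_insert_iff, hmem, Set.mem_compl_iff, Set.mem_singleton_iff]
    constructor
    · rintro (rfl | h)
      · exact Ne.symm hcd
      · exact h.1
    · intro h
      by_cases hx : x = d
      · exact Or.inl hx
      · exact Or.inr ⟨h, hx⟩
  have hd : ¬ IsPrimeSet σ.col (insert d ({c, d}ᶜ : Set (Fin σ.size))) := by
    rw [hins]
    intro h
    refine hn ((isSimple_deletePoint_iff σ c).2 ⟨?_, h⟩)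
    have h1 := c.2
    have h2 := d.2
    have h3 : c.1 ≠ d.1 := fun h => hcd (Fin.ext h)
    omega
  rcases hX.insert_cases hd with h | ⟨u, hu, h⟩
  · exact Or.inl fun x hx hx' y hy hy' => h x ((hmem x).2 ⟨hx, hx'⟩) y ((hmem y).2 ⟨hy, hy'⟩)
  right
  have hu' := (hmem u).1 hu
  have htw : ∀ z, z ≠ u → z ≠ c → z ≠ d → σ.col z u = σ.col z d :=
    fun z hz hzc hzd => h z ((hmem z).2 ⟨hzc, hzd⟩) hz
  have hfc : ∀ i, f i ≠ c ∧ f i ≠ d := fun i => (hmem _).1 (hr ▸ Set.mem_range_self i)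
  -- The copy of `π` is rerouted through `d` in place of its twin `u`, so it now misses `c` and `u`.
  refine ⟨u, hu'.1, hu'.2, htw, fun i => if f i = u then d else f i, ?_, ?_⟩
  · refine IsEmb.of_col fun i j => ?_
    rw [hf.col_eq]
    by_cases hi : f i = u <;> by_cases hj : f j = u
    · rw [if_pos hi, if_pos hj, hi, hj, col_eq_iff]
      simp
    · rw [if_pos hi, if_neg hj, hi]
      exact col_reversible σ _ _ _ _ hj (hfc j).2 (htw _ hj (hfc j).1 (hfc j).2)
    · rw [if_neg hi, if_pos hj, hj]
      exact htw _ hi (hfc i).1 (hfc i).2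
    · rw [if_neg hi, if_neg hj]
  · ext x
    simp only [Set.mem_range, Set.mem_compl_iff, Set.mem_insert_iff, Set.mem_singleton_iff, not_or]
    constructor
    · rintro ⟨i, rfl⟩
      split_ifs with hi
      · exact ⟨Ne.symm hcd, Ne.symm hu'.2⟩
      · exact ⟨(hfc i).1, hi⟩
    · rintro ⟨hxc, hxu⟩
      by_cases hxd : x = d
      · have : u ∈ Set.range f := hr ▸ hu
        obtain ⟨i, hi⟩ := this
        exact ⟨i, by rw [if_pos hi, hxd]⟩
      · have : x ∈ Set.range f := hr ▸ (hmem x).2 ⟨hxc, hxd⟩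
        obtain ⟨i, rfl⟩ := this
        exact ⟨i, if_neg hxu⟩

/-- Two points that are distinguished at most by `c` in a linear order are adjacent, or they are
separated exactly by `c`. -/
theorem adjacent_or_separated {n : ℕ} (e : Equiv.Perm (Fin n)) {u c d : Fin n} (hud : u ≠ d)
    (h : ∀ z, z ≠ u → z ≠ c → z ≠ d → (e z < e u ↔ e z < e d)) :
    ((e u).1 + 1 = (e d).1 ∨ (e d).1 + 1 = (e u).1) ∨
      ((e u).1 + 1 = (e c).1 ∧ (e c).1 + 1 = (e d).1 ∨
        (e d).1 + 1 = (e c).1 ∧ (e c).1 + 1 = (e u).1) := by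
  have key : ∀ u d : Fin n, (∀ z, z ≠ u → z ≠ c → z ≠ d → (e z < e u ↔ e z < e d)) → e u < e d →
      (e u).1 + 1 = (e d).1 ∨ (e u).1 + 1 = (e c).1 ∧ (e c).1 + 1 = (e d).1 := by
    intro u d h hlt
    by_cases hadj : (e u).1 + 1 = (e d).1
    · exact Or.inl hadj
    right
    -- `x` is just above `u` and `y` just below `d`; both distinguish `u` from `d`, so both are `c`.
    obtain ⟨x, hx⟩ := e.surjective ⟨(e u).1 + 1, by omega⟩
    obtain ⟨y, hy⟩ := e.surjective ⟨(e d).1 - 1, by omega⟩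
    have hx : (e x).1 = (e u).1 + 1 := by rw [hx]
    have hy : (e y).1 = (e d).1 - 1 := by rw [hy]
    have hxc : x = c := by
      by_contra hxc
      have := h x (by rintro rfl; omega) hxc (by rintro rfl; omega)
      omega
    have hyc : y = c := by
      by_contra hyc
      have := h y (by rintro rfl; omega) hyc (by rintro rfl; omega)
      omega
    subst hxc
    subst hyc
    omega
  have hne : e u ≠ e d := fun h => hud (e.injective h)
  rcases lt_or_gt_of_ne hne with hlt | hlt
  · rcases key u d h hlt with h | h
    · exact Or.inl (Or.inl h)
    · exact Or.inr (Or.inl h)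
  · rcases key d u (fun z h1 h2 h3 => (h z h3 h2 h1).symm) hlt with h | h
    · exact Or.inl (Or.inr h)
    · exact Or.inr (Or.inr h)

/-- No two points of a simple permutation are adjacent both in position and in value. -/
theorem IsSimple.not_adjacent {σ : Permutation} (hσ : σ.IsSimple) (hn : 4 ≤ σ.size)
    {u d : Fin σ.size} (h1 : u.1 + 1 = d.1 ∨ d.1 + 1 = u.1)
    (h2 : (σ.2 u).1 + 1 = (σ.2 d).1 ∨ (σ.2 d).1 + 1 = (σ.2 u).1) : False := by
  refine (hσ.module_trivial (fun x => x = u ∨ x = d) ?_).elim (fun h => ?_) (fun h => ?_)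
  rotate_left
  · have := h u (Or.inl rfl) d (Or.inr rfl)
    subst this
    omega
  · obtain ⟨x, -, -, h1, h2, -, -⟩ := exists_ne_of_four_le hn u d
    exact (h x).elim h1 h2
  · intro z hz
    have hz1 : z ≠ u := fun h => hz (Or.inl h)
    have hz2 : z ≠ d := fun h => hz (Or.inr h)
    have e1 : σ.2 z ≠ σ.2 u := fun h => hz1 (σ.2.injective h)
    have e2 : σ.2 z ≠ σ.2 d := fun h => hz2 (σ.2.injective h)
    rintro x (rfl | rfl) y (rfl | rfl) <;> omega

/-- No three points of a simple permutation are consecutive both in position and in value. -/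
theorem IsSimple.not_three_consecutive {σ : Permutation} (hσ : σ.IsSimple) (hn : 4 ≤ σ.size)
    {u c d : Fin σ.size} (i j : ℕ) (huc : u ≠ c) (hud : u ≠ d) (hcd : c ≠ d)
    (hu : i ≤ u.1 ∧ u.1 ≤ i + 2) (hc : i ≤ c.1 ∧ c.1 ≤ i + 2) (hd : i ≤ d.1 ∧ d.1 ≤ i + 2)
    (hu' : j ≤ (σ.2 u).1 ∧ (σ.2 u).1 ≤ j + 2) (hc' : j ≤ (σ.2 c).1 ∧ (σ.2 c).1 ≤ j + 2)
    (hd' : j ≤ (σ.2 d).1 ∧ (σ.2 d).1 ≤ j + 2) : False := by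
  have e1 : σ.2 u ≠ σ.2 c := fun h => huc (σ.2.injective h)
  have e2 : σ.2 u ≠ σ.2 d := fun h => hud (σ.2.injective h)
  have e3 : σ.2 c ≠ σ.2 d := fun h => hcd (σ.2.injective h)
  refine (hσ.module_trivial (fun x => x = u ∨ x = c ∨ x = d) ?_).elim (fun h => ?_) (fun h => ?_)
  rotate_left
  · exact huc (h u (Or.inl rfl) c (Or.inr (Or.inl rfl)))
  · have hcard : (Finset.univ : Finset (Fin σ.size)).card ≤ 3 := by
      refine (Finset.card_le_card (t := {u, c, d}) fun x _ => ?_).trans Finset.card_le_three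
      have hx : x = u ∨ x = c ∨ x = d := h x
      simpa using hx
    rw [Finset.card_univ, Fintype.card_fin] at hcard
    omega
  · intro z hz
    have hz1 : z ≠ u := fun h => hz (Or.inl h)
    have hz2 : z ≠ c := fun h => hz (Or.inr (Or.inl h))
    have hz3 : z ≠ d := fun h => hz (Or.inr (Or.inr h))
    have f1 : σ.2 z ≠ σ.2 u := fun h => hz1 (σ.2.injective h)
    have f2 : σ.2 z ≠ σ.2 c := fun h => hz2 (σ.2.injective h)
    have f3 : σ.2 z ≠ σ.2 d := fun h => hz3 (σ.2.injective h)
    have a1 : z.1 < i ∨ i + 2 < z.1 := by omega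
    have a2 : (σ.2 z).1 < j ∨ j + 2 < (σ.2 z).1 := by omega
    rintro x (rfl | rfl | rfl) y (rfl | rfl | rfl) <;> omega

/-- A corner of a simple permutation is not occupied. -/
theorem IsSimple.not_corner {σ : Permutation} (hσ : σ.IsSimple) (hn : 4 ≤ σ.size)
    {p : Fin σ.size} (h1 : p.1 = 0 ∨ p.1 + 1 = σ.size)
    (h2 : (σ.2 p).1 = 0 ∨ (σ.2 p).1 + 1 = σ.size) : False := by
  have hs : σ.size = σ.1 := rfl
  refine (hσ.module_trivial (fun x => x ≠ p) ?_).elim (fun h => ?_) (fun h => ?_)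
  rotate_left
  · obtain ⟨x, y, hxy, h1, h2, h3, h4⟩ := exists_ne_of_four_le hn p p
    exact hxy (h x h1 y h3)
  · exact h p rfl
  · intro z hz x hx y hy
    obtain rfl : z = p := not_not.1 hz
    have hx : x ≠ z := hx
    have hy : y ≠ z := hy
    have f1 : σ.2 x ≠ σ.2 z := fun h => hx (σ.2.injective h)
    have f2 : σ.2 y ≠ σ.2 z := fun h => hy (σ.2.injective h)
    omega

/-- Twins `u`, `d` separated by `c` are separated either in position or in value. -/
theorem IsSimple.twin_geometry {σ : Permutation} (hσ : σ.IsSimple) (hn : 4 ≤ σ.size)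
    {u c d : Fin σ.size} (huc : u ≠ c) (hud : u ≠ d) (hcd : c ≠ d)
    (h : ∀ z, z ≠ u → z ≠ c → z ≠ d → σ.col z u = σ.col z d) :
    ((u.1 + 1 = c.1 ∧ c.1 + 1 = d.1 ∨ d.1 + 1 = c.1 ∧ c.1 + 1 = u.1) ∧
        ((σ.2 u).1 + 1 = (σ.2 d).1 ∨ (σ.2 d).1 + 1 = (σ.2 u).1)) ∨
      ((u.1 + 1 = d.1 ∨ d.1 + 1 = u.1) ∧
        ((σ.2 u).1 + 1 = (σ.2 c).1 ∧ (σ.2 c).1 + 1 = (σ.2 d).1 ∨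
          (σ.2 d).1 + 1 = (σ.2 c).1 ∧ (σ.2 c).1 + 1 = (σ.2 u).1)) := by
  have h1 := adjacent_or_separated (Equiv.refl (Fin σ.size)) hud
    (c := c) fun z h1 h2 h3 => (col_eq_iff.1 (h z h1 h2 h3)).1
  have h2 := adjacent_or_separated σ.2 hud
    (c := c) fun z h1 h2 h3 => (col_eq_iff.1 (h z h1 h2 h3)).2
  simp only [Equiv.refl_apply] at h1
  -- Adjacency in both orders gives an interval of two points, separation by `c` in both gives one
  -- of three.
  rcases h1 with h1 | h1 <;> rcases h2 with h2 | h2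
  · exact (hσ.not_adjacent hn h1 h2).elim
  · exact Or.inr ⟨h1, h2⟩
  · exact Or.inl ⟨h1, h2⟩
  · exact (hσ.not_three_consecutive hn (min u.1 d.1) (min (σ.2 u).1 (σ.2 d).1) huc hud hcd
      (by omega) (by omega) (by omega) (by omega) (by omega) (by omega)).elim

/-- One step along the path of twins. -/
theorem CopyOff.step {π σ : Permutation} {x c d : Fin σ.size} (h : CopyOff π σ c d)
    (hσ : σ.IsSimple) (hn : 4 ≤ σ.size) (hπ : π.IsSimple) (hc : ¬ (σ.deletePoint c).IsSimple)
    (hx : x.1 + 1 = d.1 ∧ d.1 + 1 = c.1 ∨ c.1 + 1 = d.1 ∧ d.1 + 1 = x.1) :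
    (∀ x, x ≠ c → x ≠ d → ∀ y, y ≠ c → y ≠ d → σ.col d x = σ.col d y) ∨
      ∃ u, CopyOff π σ c u ∧
        (u.1 + 1 = c.1 ∧ c.1 + 1 = d.1 ∨ d.1 + 1 = c.1 ∧ c.1 + 1 = u.1) ∧
        ((σ.2 u).1 + 1 = (σ.2 d).1 ∨ (σ.2 d).1 + 1 = (σ.2 u).1) := by
  have hcd : c ≠ d := by
    rintro rfl
    omega
  rcases h.corner_or_twin hcd hπ hc with h | ⟨u, huc, hud, htw, hu⟩
  · exact Or.inl h
  right
  rcases hσ.twin_geometry hn huc hud hcd htw with ⟨h1, h2⟩ | ⟨h1, h2⟩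
  · exact ⟨u, hu, h1, h2⟩
  -- If `u` is next to `d` in position, then `u` is `x`, because the other neighbour of `d` is `c`.
  -- Then `x`, `d`, `c` are consecutive in position and in value.
  · exfalso
    have huc' : u.1 ≠ c.1 := fun h => huc (Fin.ext h)
    exact hσ.not_three_consecutive hn (min c.1 x.1) (min (σ.2 u).1 (σ.2 d).1) huc hud hcd
      (by omega) (by omega) (by omega) (by omega) (by omega) (by omega)

end Permutation

/-! ### Words whose letters at distance two are adjacent -/

/-- An injective walk on the integers does not turn back. -/
theorem walk_eq_arith {L : ℕ} (w : ℕ → ℤ) (hE : ∀ i, i + 1 < L → w (i + 1) - w i = 1 ∨ w (i + 1) - w i = -1)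
    (hinj : ∀ i, i + 2 < L → w (i + 2) ≠ w i) :
    (∀ i < L, w i = w 0 + i) ∨ ∀ i < L, w i = w 0 - i := by
  by_cases hL : 1 < L
  · rcases hE 0 hL with h0 | h0
    · left
      have key : ∀ i, (i < L → w i = w 0 + i) ∧ (i + 1 < L → w (i + 1) = w 0 + (i + 1 : ℕ)) := by
        intro i
        induction i with
        | zero => exact ⟨fun _ => by simp, fun _ => by push_cast; simp at h0 ⊢; omega⟩
        | succ i ih =>
          refine ⟨ih.2, fun h => ?_⟩
          have h1 := ih.1 (by omega)
          have h2 := ih.2 (by omega)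
          have h3 := hE (i + 1) h
          have h4 := hinj i h
          push_cast at *
          rw [show i + 1 + 1 = i + 2 by rfl] at *
          omega
      exact fun i hi => (key i).1 hi
    · right
      have key : ∀ i, (i < L → w i = w 0 - i) ∧ (i + 1 < L → w (i + 1) = w 0 - (i + 1 : ℕ)) := by
        intro i
        induction i with
        | zero => exact ⟨fun _ => by simp, fun _ => by push_cast; simp at h0 ⊢; omega⟩
        | succ i ih =>
          refine ⟨ih.2, fun h => ?_⟩
          have h1 := ih.1 (by omega)
          have h2 := ih.2 (by omega)
          have h3 := hE (i + 1) h
          have h4 := hinj i h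
          push_cast at *
          rw [show i + 1 + 1 = i + 2 by rfl] at *
          omega
      exact fun i hi => (key i).1 hi
  · left
    intro i hi
    obtain rfl : i = 0 := by omega
    simp

/-- A bijective word on `0, …, n - 1` whose letters at distance two are adjacent, with least letter
at position `1` and no letter in a corner, is the exceptional word of type 3. -/
theorem eq_exceptional_word_of_min {n : ℕ} (hn : 5 ≤ n) (v : ℕ → ℤ) (hb : ∀ i < n, 0 ≤ v i ∧ v i < n)
    (hinj : ∀ i < n, ∀ j < n, v i = v j → i = j) (hsurj : ∀ y : ℤ, 0 ≤ y → y < n → ∃ i < n, v i = y)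
    (hE : ∀ i, i + 2 < n → v (i + 2) - v i = 1 ∨ v (i + 2) - v i = -1) (h1 : v 1 = 0)
    (h0 : v 0 ≠ n - 1) (hl : v (n - 1) ≠ n - 1) :
    ∃ m, n = 2 * m ∧ ∀ i < n, v i = if i % 2 = 0 then (m : ℤ) + (i / 2 : ℕ) else (i / 2 : ℕ) := by
  -- The walk on the odd positions starts at the minimum, so it can only go up.
  have hodd : ∀ i, 2 * i + 1 < n → v (2 * i + 1) = i := by
    have := walk_eq_arith (L := n / 2) (fun i => v (2 * i + 1))
      (fun i hi => hE (2 * i + 1) (by omega))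
      (fun i hi h => by
        have := hinj (2 * (i + 2) + 1) (by omega) (2 * i + 1) (by omega) h
        omega)
    simp only [mul_zero, zero_add, h1] at this
    rcases this with h | h
    · intro i hi
      exact h i (by omega)
    · exfalso
      have h2 := h 1 (by omega)
      have h3 := hb (2 * 1 + 1) (by omega)
      omega
  have heven := walk_eq_arith (L := (n + 1) / 2) (fun i => v (2 * i))
      (fun i hi => hE (2 * i) (by omega))
      (fun i hi h => by
        have := hinj (2 * (i + 2)) (by omega) (2 * i) (by omega) h
        omega)
  simp only [mul_zero] at heven
  rcases heven with heven | heven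
  -- The odd positions use exactly the values below `n / 2`, so the ascending walk on the even
  -- positions starts at `n / 2`.
  · have e0 : v 0 = (n / 2 : ℕ) := by
      apply le_antisymm
      · obtain ⟨p, hp, hpv⟩ := hsurj (n / 2 : ℕ) (by omega) (by omega)
        rcases Nat.even_or_odd' p with ⟨q, rfl | rfl⟩
        · have := heven q (by omega)
          omega
        · have := hodd q hp
          omega
      · by_contra! hlt
        have h2 := hb 0 (by omega)
        have h3 := hodd (v 0).toNat (by omega)
        have h4 := hinj 0 (by omega) (2 * (v 0).toNat + 1) (by omega) (by rw [h3]; omega)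
        omega
    rcases Nat.even_or_odd' n with ⟨m, rfl | rfl⟩
    · refine ⟨m, rfl, fun i hi => ?_⟩
      rcases Nat.even_or_odd' i with ⟨q, rfl | rfl⟩
      · rw [if_pos (by omega), heven q (by omega), e0]
        omega
      · rw [if_neg (by omega), hodd q hi]
        omega
    -- For odd `n` the last position is even and would carry the maximum.
    · exfalso
      apply hl
      have h2 := heven m (by omega)
      rw [show 2 * m + 1 - 1 = 2 * m by omega, h2, e0]
      push_cast
      omega
  -- A descending walk on the even positions would start at the maximum, against `h0`.
  · exfalso
    obtain ⟨p, hp, hpv⟩ := hsurj (n - 1) (by omega) (by omega)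
    rcases Nat.even_or_odd' p with ⟨q, rfl | rfl⟩
    · have h2 := heven q (by omega)
      have h3 := hb 0 (by omega)
      omega
    · have := hodd q hp
      omega

/-- Complementing the values reduces a maximum at position 1 to a minimum there, and exchanges types
3 and 4. -/
theorem eq_exceptional_word {n : ℕ} (hn : 5 ≤ n) (v : ℕ → ℤ) (hb : ∀ i < n, 0 ≤ v i ∧ v i < n)
    (hinj : ∀ i < n, ∀ j < n, v i = v j → i = j) (hsurj : ∀ y : ℤ, 0 ≤ y → y < n → ∃ i < n, v i = y)
    (hE : ∀ i, i + 2 < n → v (i + 2) - v i = 1 ∨ v (i + 2) - v i = -1)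
    (h1 : v 1 = 0 ∨ v 1 = n - 1) (h0 : v 0 ≠ 0 ∧ v 0 ≠ n - 1)
    (hl : v (n - 1) ≠ 0 ∧ v (n - 1) ≠ n - 1) :
    ∃ m : ℕ, n = 2 * m ∧
      ((∀ i < n, v i = ((if i % 2 = 0 then m + i / 2 else i / 2 : ℕ) : ℤ)) ∨
        ∀ i < n, v i = ((if i % 2 = 0 then m - 1 - i / 2 else 2 * m - 1 - i / 2 : ℕ) : ℤ)) := by
  rcases h1 with h1 | h1
  · obtain ⟨m, hm, h⟩ := eq_exceptional_word_of_min hn v hb hinj hsurj hE h1 h0.2 hl.2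
    refine ⟨m, hm, Or.inl fun i hi => ?_⟩
    rw [h i hi]
    push_cast
    rfl
  · obtain ⟨m, hm, h⟩ := eq_exceptional_word_of_min hn (fun i => n - 1 - v i)
      (fun i hi => by have := hb i hi; omega)
      (fun i hi j hj hij => hinj i hi j hj (by simpa using hij))
      (fun y hy hyn => by
        obtain ⟨i, hi, h⟩ := hsurj (n - 1 - y) (by omega) (by omega)
        exact ⟨i, hi, by rw [h]; ring⟩)
      (fun i hi => by have := hE i hi; omega) (by rw [h1]; ring)
      (by have := h0.1; omega) (by have := hl.1; omega)
    refine ⟨m, hm, Or.inr fun i hi => ?_⟩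
    have := h i hi
    split_ifs at this ⊢ <;> omega

/-! ### Following the path of twins -/

namespace Permutation

/-- The values at distance two from position `i` are adjacent. -/
def TwinsAt (σ : Permutation) (i : ℕ) : Prop :=
  ∀ a b : Fin σ.size, a.1 = i → b.1 = i + 2 →
    (σ.2 a).1 + 1 = (σ.2 b).1 ∨ (σ.2 b).1 + 1 = (σ.2 a).1

section Path

variable {π σ : Permutation}

/-- Each `CopyOff.step` shifts the missing pair one position to the left and yields new twins at
distance two; `hno` makes the step available every time. Only at the left end can it stop, with the
point at position 1 seeing all remaining points alike. -/
theorem twins_left (hσ : σ.IsSimple) (hn : 4 ≤ σ.size) (hπ : π.IsSimple)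
    (hno : ∀ i, π.IsPatternOf (σ.deletePoint i) → ¬ (σ.deletePoint i).IsSimple) (k : ℕ) :
    ∀ x d c : Fin σ.size, x.1 = k + 2 → d.1 = k + 1 → c.1 = k → CopyOff π σ c d → σ.TwinsAt k →
      (∀ i ≤ k, σ.TwinsAt i) ∧ ∃ c d : Fin σ.size, c.1 = 0 ∧ d.1 = 1 ∧ CopyOff π σ c d ∧
        ∀ x, x ≠ c → x ≠ d → ∀ y, y ≠ c → y ≠ d → σ.col d x = σ.col d y := by
  induction k with
  | zero =>
    intro x d c hx hd hc h hE
    refine ⟨fun i hi => ?_, c, d, hc, hd, h, ?_⟩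
    · obtain rfl : i = 0 := by omega
      exact hE
    · rcases h.step (x := x) hσ hn hπ (hno _ h.isPatternOf_deletePoint) (by omega) with h | ⟨u, -, h, -⟩
      · exact h
      · omega
  | succ k ih =>
    intro x d c hx hd hc h hE
    rcases h.step (x := x) hσ hn hπ (hno _ h.isPatternOf_deletePoint) (by omega) with h | ⟨u, hu, h1, h2⟩
    -- `d` has `x` on its right and position `k` on its left, so it cannot see them alike.
    · exfalso
      have h3 := h x (by rintro rfl; omega) (by rintro rfl; omega)
        ⟨k, by omega⟩
        (fun h => by have := congrArg Fin.val h; simp only at this; omega) (fun h => by have := congrArg Fin.val h; simp only at this; omega)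
      have h4 := (col_eq_iff.1 h3).1
      rw [Fin.lt_def, Fin.lt_def] at h4
      simp only at h4
      omega
    · have hE' : σ.TwinsAt k := by
        intro a b ha hb
        obtain rfl : a = u := Fin.ext (by omega)
        obtain rfl : b = d := Fin.ext (by omega)
        exact h2
      obtain ⟨h3, h4⟩ := ih d c u (by omega) hc (by omega) hu.symm hE'
      refine ⟨fun i hi => ?_, h4⟩
      rcases Nat.lt_or_ge k i with h | h
      · obtain rfl : i = k + 1 := by omega
        exact hE
      · exact h3 i h

/-- Mirror image of `twins_left`, with `j` counting the positions to the right of the current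
triple. The right end needs no record: the last letter is controlled by `IsSimple.not_corner`. -/
theorem twins_right (hσ : σ.IsSimple) (hn : 4 ≤ σ.size) (hπ : π.IsSimple)
    (hno : ∀ i, π.IsPatternOf (σ.deletePoint i) → ¬ (σ.deletePoint i).IsSimple) (j : ℕ) :
    ∀ k, k + 3 + j = σ.size → ∀ x d c : Fin σ.size, x.1 = k → d.1 = k + 1 → c.1 = k + 2 →
      CopyOff π σ c d → σ.TwinsAt k → ∀ i, k ≤ i → σ.TwinsAt i := by
  induction j with
  | zero =>
    intro k hk x d c hx hd hc h hE i hi a b ha hb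
    obtain rfl : i = k := by omega
    exact hE a b ha hb
  | succ j ih =>
    intro k hk x d c hx hd hc h hE
    rcases h.step (x := x) hσ hn hπ (hno _ h.isPatternOf_deletePoint) (by omega) with h | ⟨u, hu, h1, h2⟩
    · exfalso
      have h3 := h x (by rintro rfl; omega) (by rintro rfl; omega)
        ⟨k + 3, by omega⟩
        (fun h => by have := congrArg Fin.val h; simp only at this; omega) (fun h => by have := congrArg Fin.val h; simp only at this; omega)
      have h4 := (col_eq_iff.1 h3).1
      rw [Fin.lt_def, Fin.lt_def] at h4
      simp only at h4
      omega
    · have hE' : σ.TwinsAt (k + 1) := by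
        intro a b ha hb
        obtain rfl : b = u := Fin.ext (by omega)
        obtain rfl : a = d := Fin.ext (by omega)
        exact h2.symm
      have h3 := ih (k + 1) (by omega) d c u (by omega) (by omega) (by omega) hu.symm hE'
      intro i hi
      rcases Nat.lt_or_ge k i with h | h
      · exact h3 i h
      · obtain rfl : i = k := by omega
        exact hE

/-- A simple permutation made of twins at distance two is exceptional. -/
theorem eq_exceptional_of_twins (hσ : σ.IsSimple) (hn : 5 ≤ σ.size) (hE : ∀ i, σ.TwinsAt i)
    {c d : Fin σ.size} (hc : c.1 = 0) (hd : d.1 = 1)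
    (h : ∀ x, x ≠ c → x ≠ d → ∀ y, y ≠ c → y ≠ d → σ.col d x = σ.col d y) :
    ∃ m, 2 ≤ m ∧ (σ = exceptional .three (m + 1) ∨ σ = exceptional .four (m + 1)) := by
  obtain ⟨n, s⟩ := σ
  have hn : 5 ≤ n := hn
  let v : ℕ → ℤ := fun i => if hi : i < n then ((s ⟨i, hi⟩).1 : ℤ) else 0
  have hv : ∀ i : Fin n, v i.1 = (s i).1 := fun i => by simp [v]
  have hv' : ∀ i (hi : i < n), v i = (s ⟨i, hi⟩).1 := fun i hi => by simp [v, hi]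
  have hcorner : ∀ i : Fin n, (i.1 = 0 ∨ i.1 + 1 = n) → (s i).1 ≠ 0 ∧ (s i).1 + 1 ≠ n :=
    fun i hi => ⟨fun h => hσ.not_corner (by change 4 ≤ n; omega) hi (Or.inl h),
      fun h => hσ.not_corner (by change 4 ≤ n; omega) hi (Or.inr h)⟩
  have h0 := hcorner ⟨0, by omega⟩ (Or.inl rfl)
  have hl := hcorner ⟨n - 1, by omega⟩ (Or.inr (by simp only; omega))
  rw [← Nat.cast_ne_zero (R := ℤ), ← hv] at h0 hl
  -- Otherwise `d` distinguishes the points carrying the least and the greatest value; neither of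
  -- these is `c`, which would then be a corner.
  have h1 : v 1 = 0 ∨ v 1 = n - 1 := by
    change Fin n at c d
    have hvd : v 1 = (s d).1 := hd ▸ hv d
    have hc0 := hcorner c (Or.inl hc)
    by_contra! hcon
    obtain ⟨x, hx⟩ := s.surjective ⟨0, by omega⟩
    obtain ⟨y, hy⟩ := s.surjective ⟨n - 1, by omega⟩
    have hx0 : (s x).1 = 0 := by rw [hx]
    have hy0 : (s y).1 = n - 1 := by rw [hy]
    have h3 := h x (by rintro rfl; exact hc0.1 hx0) (by rintro rfl; omega) y
      (by rintro rfl; omega) (by rintro rfl; omega)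
    have h4 : s d < s x ↔ s d < s y := (col_eq_iff.1 h3).2
    rw [Fin.lt_def, Fin.lt_def] at h4
    omega
  obtain ⟨m, rfl, hm⟩ := eq_exceptional_word hn v
    (fun i hi => by rw [hv' i hi]; omega)
    (fun i hi j hj hij => by
      rw [hv' i hi, hv' j hj] at hij
      exact Fin.mk.inj_iff.1 (s.injective (Fin.ext (by exact_mod_cast hij))))
    (fun y hy hyn => by
      obtain ⟨x, hx⟩ := s.surjective ⟨y.toNat, by omega⟩
      exact ⟨x.1, x.2, by rw [hv, hx]; simp only; omega⟩)
    (fun i hi => by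
      rw [hv' _ hi, hv' i (by omega)]
      have : (s ⟨i, by omega⟩).1 + 1 = (s ⟨i + 2, hi⟩).1 ∨ (s ⟨i + 2, hi⟩).1 + 1 = (s ⟨i, by omega⟩).1 :=
        hE i ⟨i, by change i < n; omega⟩ ⟨i + 2, hi⟩ rfl rfl
      omega)
    h1 ⟨h0.1, by have := h0.2; have := hv ⟨0, by omega⟩; simp only at this; omega⟩
    ⟨hl.1, by have := hl.2; have := hv ⟨n - 1, by omega⟩; simp only at this; omega⟩
  obtain ⟨m, rfl⟩ : ∃ k, m = k + 1 := ⟨m - 1, by omega⟩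
  refine ⟨m, by omega, hm.imp (fun hm => ?_) (fun hm => ?_)⟩
  · refine congrArg (Sigma.mk (2 * (m + 1))) (Equiv.ext fun i => Fin.ext ?_)
    have := hm i.1 i.2
    rw [hv] at this
    exact_mod_cast this
  · refine congrArg (Sigma.mk (2 * (m + 1))) (Equiv.ext fun i => Fin.ext ?_)
    have := hm i.1 i.2
    rw [hv] at this
    exact_mod_cast this

end Path

end Permutation

/-! ### Critical pairs and the structure theorem -/

namespace Permutation

theorem CopyOff.unique {π ρ σ : Permutation} {a b : Fin σ.size} (h : CopyOff π σ a b)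
    (h' : CopyOff ρ σ a b) : π = ρ := by
  obtain ⟨f, hf, hr⟩ := h
  obtain ⟨g, hg, hr'⟩ := h'
  have h1 := hf.isPatternOf hg (by rw [hr, hr'])
  have h2 := hg.isPatternOf hf (by rw [hr, hr'])
  exact h1.eq_of_size_eq (le_antisymm h1.size_le h2.size_le)

theorem copyOff_of_shift {π σ : Permutation} (hs : π.size + 2 = σ.size)
    (h : ∀ i j : Fin π.size, π.2 i < π.2 j ↔
      σ.2 (⟨i.1 + 2, by omega⟩ : Fin σ.size) < σ.2 (⟨j.1 + 2, by omega⟩ : Fin σ.size))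
    {c d : Fin σ.size} (hc : c.1 = 0) (hd : d.1 = 1) : CopyOff π σ c d := by
  refine ⟨fun i => ⟨i.1 + 2, by omega⟩, ⟨fun i j hij => ?_, h⟩, ?_⟩
  · rw [Fin.lt_def] at hij ⊢
    simp only
    omega
  · ext x
    simp only [Set.mem_range, Set.mem_compl_iff, Set.mem_insert_iff, Set.mem_singleton_iff,
      Fin.ext_iff, hc, hd]
    constructor
    · rintro ⟨y, hy⟩
      omega
    · intro hx
      exact ⟨⟨x.1 - 2, by omega⟩, by simp only; omega⟩

theorem copyOff_exceptional_three (m : ℕ) {c d : Fin (exceptional .three (m + 1)).size}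
    (hc : c.1 = 0) (hd : d.1 = 1) :
    CopyOff (exceptional .three m) (exceptional .three (m + 1)) c d := by
  refine copyOff_of_shift (by change 2 * m + 2 = 2 * (m + 1); ring) (fun i j => ?_) hc hd
  have hi := i.2
  have hj := j.2
  have hs : (exceptional .three m).size = 2 * m := rfl
  rw [Fin.lt_def, Fin.lt_def, exceptional_three_val, exceptional_three_val, exceptional_three_val,
    exceptional_three_val]
  simp only
  split_ifs <;> omega

theorem copyOff_exceptional_four (m : ℕ) {c d : Fin (exceptional .four (m + 1)).size}
    (hc : c.1 = 0) (hd : d.1 = 1) :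
    CopyOff (exceptional .four m) (exceptional .four (m + 1)) c d := by
  refine copyOff_of_shift (by change 2 * m + 2 = 2 * (m + 1); ring) (fun i j => ?_) hc hd
  have hi := i.2
  have hj := j.2
  have hs : (exceptional .four m).size = 2 * m := rfl
  rw [Fin.lt_def, Fin.lt_def, exceptional_four_val, exceptional_four_val, exceptional_four_val,
    exceptional_four_val]
  simp only
  split_ifs <;> omega

section Critical

variable {π σ : Permutation}

/-- The path of twins is followed from `c` in both directions and covers all of `σ`, which is
therefore exceptional. At its left end `π` is the copy missing the first two positions, which is the
previous exceptional permutation. -/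
theorem exceptional_of_twins (hσ : σ.IsSimple) (hn : 5 ≤ σ.size) (hπ : π.IsSimple)
    (hno : ∀ i, π.IsPatternOf (σ.deletePoint i) → ¬ (σ.deletePoint i).IsSimple)
    {u c d : Fin σ.size} (hd : CopyOff π σ c d) (hu : CopyOff π σ c u)
    (hpos : u.1 + 1 = c.1 ∧ c.1 + 1 = d.1 ∨ d.1 + 1 = c.1 ∧ c.1 + 1 = u.1)
    (hval : (σ.2 u).1 + 1 = (σ.2 d).1 ∨ (σ.2 d).1 + 1 = (σ.2 u).1) :
    ∃ t m, 2 ≤ m ∧ σ = exceptional t (m + 1) ∧ π = exceptional t m := by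
  wlog h : u.1 + 1 = c.1 ∧ c.1 + 1 = d.1 generalizing u d
  · exact this hu hd hpos.symm hval.symm (hpos.resolve_left h)
  have hE : σ.TwinsAt u.1 := by
    intro a b ha hb
    obtain rfl : a = u := Fin.ext ha
    obtain rfl : b = d := Fin.ext (by omega)
    exact hval
  obtain ⟨hl, c', d', hc', hd', hcopy, hcor⟩ := twins_left hσ (by omega) hπ hno u.1 d c u (by omega)
    h.1.symm rfl hu.symm hE
  have hr := twins_right hσ (by omega) hπ hno (σ.size - (u.1 + 3)) u.1 (by omega) u c d rfl
    h.1.symm (by omega) hd.symm hE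
  obtain ⟨m, hm, rfl | rfl⟩ := eq_exceptional_of_twins hσ hn
    (fun i => (le_total i u.1).elim (hl i) (hr i)) hc' hd' hcor
  · exact ⟨.three, m, hm, rfl, hcopy.unique (copyOff_exceptional_three m hc' hd')⟩
  · exact ⟨.four, m, hm, rfl, hcopy.unique (copyOff_exceptional_four m hc' hd')⟩

theorem exceptional_of_inv (h : ∃ t m, 2 ≤ m ∧ σ.inv = exceptional t (m + 1) ∧
      π.inv = exceptional t m) :
    ∃ t m, 2 ≤ m ∧ σ = exceptional t (m + 1) ∧ π = exceptional t m := by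
  obtain ⟨t, m, hm, h1, h2⟩ := h
  have h1 : σ = (exceptional t (m + 1)).inv := by rw [← h1, inv_inv]
  have h2 : π = (exceptional t m).inv := by rw [← h2, inv_inv]
  cases t with
  | one => exact ⟨.three, m, hm, h1, h2⟩
  | two => exact ⟨.four, m, hm, h1, h2⟩
  | three => exact ⟨.one, m, hm, h1, h2⟩
  | four => exact ⟨.two, m, hm, h1, h2⟩

theorem no_deletePoint_inv
    (hno : ∀ i, π.IsPatternOf (σ.deletePoint i) → ¬ (σ.deletePoint i).IsSimple) (i : Fin σ.inv.size) :
    π.inv.IsPatternOf (σ.inv.deletePoint i) → ¬ (σ.inv.deletePoint i).IsSimple := by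
  intro h hs
  obtain ⟨j, hj⟩ := (deletePoint_isPatternOf σ.inv i).inv.exists_eq_deletePoint
    (deletePoint_size σ.inv i)
  change _ = σ.deletePoint j at hj
  exact hno j (hj ▸ h.inv) (hj ▸ hs.inv)

/-- If `π` is obtained from `σ` by deleting two points, but not through a simple permutation of
intermediate size, then `π` and `σ` are exceptional of the same type. -/
theorem exceptional_of_critical (hσ : σ.IsSimple) (hn : 5 ≤ σ.size) (hπ : π.IsSimple)
    (hno : ∀ i, π.IsPatternOf (σ.deletePoint i) → ¬ (σ.deletePoint i).IsSimple)
    {a b : Fin σ.size} (hab : a ≠ b) (h : CopyOff π σ a b) :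
    ∃ t m, 2 ≤ m ∧ σ = exceptional t (m + 1) ∧ π = exceptional t m := by
  have key : ∀ {a b : Fin σ.size}, a ≠ b → CopyOff π σ a b →
      (∀ x, x ≠ a → x ≠ b → ∀ y, y ≠ a → y ≠ b → σ.col b x = σ.col b y) ∨
      ∃ t m, 2 ≤ m ∧ σ = exceptional t (m + 1) ∧ π = exceptional t m := by
    intro a b hab h
    rcases h.corner_or_twin hab hπ (hno _ h.isPatternOf_deletePoint) with h1 | ⟨u, hua, hub, htw, hu⟩
    · exact Or.inl h1
    right
    rcases hσ.twin_geometry (by omega) hua hub hab htw with ⟨h1, h2⟩ | ⟨h1, h2⟩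
    · exact exceptional_of_twins hσ hn hπ hno h hu h1 h2
    -- Twins separated in value are separated in position in the inverse; this produces types 1 and
    -- 2.
    · refine exceptional_of_inv (exceptional_of_twins hσ.inv hn hπ.inv (no_deletePoint_inv hno)
        h.inv hu.inv h2 ?_)
      have e : ∀ x : Fin σ.size, σ.2.symm (σ.2 x) = x := σ.2.symm_apply_apply
      change ((σ.2.symm (σ.2 u)).1 + 1 = (σ.2.symm (σ.2 b)).1 ∨
        (σ.2.symm (σ.2 b)).1 + 1 = (σ.2.symm (σ.2 u)).1)
      rw [e, e]
      exact h1
  rcases key hab h with h1 | h1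
  · rcases key hab.symm h.symm with h2 | h2
    -- If both `a` and `b` see the other points alike, those points form a nontrivial module.
    · exfalso
      obtain ⟨x, y, hxy, hxa, hxb, hya, hyb⟩ := exists_ne_of_four_le (by omega) a b
      refine (hσ.isPrimeSet ({a, b}ᶜ) (Set.subset_univ _) ?_).elim (fun h3 => ?_) (fun h3 => ?_)
      rotate_left
      · exact hxy (h3 (by simp [hxa, hxb]) (by simp [hya, hyb]))
      · have : a ∈ ({a, b}ᶜ : Set _) := h3.symm ▸ Set.mem_univ a
        simp at this
      · intro z _ hz x hx y hy
        simp at hz hx hy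
        rcases or_iff_not_imp_left.2 hz with rfl | rfl
        · exact h2 x hx.2 hx.1 y hy.2 hy.1
        · exact h1 x hx.1 hx.2 y hy.1 hy.2
    · exact h2
  · exact h1

theorem IsEmb.ncard_range {f : Fin π.size → Fin σ.size} (hf : IsEmb π σ f) :
    (Set.range f).ncard = π.size := by
  rw [← Set.image_univ, Set.ncard_image_of_injective _ hf.1.injective, Set.ncard_univ]
  simp

/-- The main structure theorem: a proper simple pattern of a simple permutation `σ` is contained
in a simple one-point deletion of `σ`, or `σ` is exceptional and the pattern is contained in the
previous exceptional permutation of the same type. -/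
theorem simple_pattern_cases {β : Permutation} (hσ : σ.IsSimple) (hβ : β.IsSimple)
    (h4 : 4 ≤ β.size) (hp : β.IsPatternOf σ) (hlt : β.size < σ.size) :
    (∃ i, (σ.deletePoint i).IsSimple ∧ β.IsPatternOf (σ.deletePoint i)) ∨
      ∃ t m, 2 ≤ m ∧ σ = exceptional t (m + 1) ∧ β.IsPatternOf (exceptional t m) ∧
        (exceptional t m).IsPatternOf σ := by
  classical
  let P : ℕ → Prop := fun k =>
    ∃ π : Permutation, π.size = k ∧ π.IsSimple ∧ β.IsPatternOf π ∧ π.IsPatternOf σ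
  have hPβ : P β.size := ⟨β, rfl, hβ, IsPatternOf.refl β, hp⟩
  -- `π` has the largest size below that of `σ`; this forces the two-point prime extension found
  -- later to be all of `σ`.
  obtain ⟨π, hπk, hπ, hβπ, f, hf⟩ := Nat.findGreatest_spec (P := P) (n := σ.size - 1) (by omega) hPβ
  have hmax : ∀ k, k < σ.size → P k → k ≤ π.size := fun k hk hPk => by
    rw [hπk]
    exact Nat.le_findGreatest (by omega) hPk
  have hπσ : π.size < σ.size := by
    have := Nat.findGreatest_le (P := P) (σ.size - 1)
    omega
  have hf : IsEmb π σ f := hf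
  have hβs := hβπ.size_le
  by_cases hno : ∃ i, (σ.deletePoint i).IsSimple ∧ π.IsPatternOf (σ.deletePoint i)
  · obtain ⟨i, h1, h2⟩ := hno
    exact Or.inl ⟨i, h1, hβπ.trans h2⟩
  push Not at hno
  right
  have hX : IsPrimeSet σ.col (Set.range f) := (hf.isSimple_iff.1 hπ).2
  have h3 : ∀ u w, ∃ x ∈ Set.range f, x ≠ u ∧ x ≠ w := by
    intro u w
    by_contra! hcon
    have hsub : Set.range f ⊆ {u, w} := by
      intro x hx
      by_cases hxu : x = u
      · exact Or.inl hxu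
      · exact Or.inr (hcon x hx hxu)
    have h1 := Set.ncard_le_ncard hsub (Set.toFinite _)
    have h2 : ({u, w} : Set (Fin σ.size)).ncard ≤ 2 :=
      (Set.ncard_insert_le u {w}).trans (by rw [Set.ncard_singleton])
    rw [hf.ncard_range] at h1
    omega
  -- If only one point were missed, `π` would itself be a simple one-point deletion.
  have h2 : ∃ a b, a ∉ Set.range f ∧ b ∉ Set.range f ∧ a ≠ b := by
    by_contra! hcon
    have : Set.range f ≠ Set.univ := by
      intro h
      have := hf.ncard_range
      rw [h, Set.ncard_univ] at this
      simp at this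
      omega
    obtain ⟨i, hi⟩ := (Set.ne_univ_iff_exists_notMem _).1 this
    have hr : Set.range f = {i}ᶜ := by
      ext x
      refine ⟨fun hx hxi => hi (hxi ▸ hx), fun hx => ?_⟩
      by_contra hxr
      exact hx (hcon x i hxr hi)
    obtain ⟨-, g, hg, hr'⟩ := exists_isEmb_deletePoint σ i
    exact hno i ((isSimple_deletePoint_iff σ i).2 ⟨by omega, hr ▸ hX⟩)
      (hf.isPatternOf hg (by rw [hr, hr']))
  obtain ⟨a, b, ha, hb, hab, hprime⟩ :=
    hσ.isPrimeSet.exists_insert_insert (col_reversible σ) hX h3 h2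
  obtain ⟨ρ, g, hg, hr⟩ := exists_isEmb_range σ (insert a (insert b (Set.range f)))
  have hfg : Set.range f ⊆ Set.range g := by
    rw [hr]
    exact fun x hx => Or.inr (Or.inr hx)
  have hlt' : π.size < ρ.size := by
    rw [← hf.ncard_range, ← hg.ncard_range]
    refine Set.ncard_lt_ncard ⟨hfg, fun h => ha (h ?_)⟩ (Set.toFinite _)
    rw [hr]
    exact Or.inl rfl
  have hρσ : ρ.size = σ.size := by
    by_contra hne
    have hle : ρ.IsPatternOf σ := ⟨g, hg⟩
    have h1 := hmax ρ.size (lt_of_le_of_ne hle.size_le hne)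
      ⟨ρ, rfl, hg.isSimple_iff.2 ⟨by omega, hr ▸ hprime⟩, hβπ.trans (hf.isPatternOf hg hfg), hle⟩
    omega
  have huniv : insert a (insert b (Set.range f)) = Set.univ := by
    rw [← hr]
    refine Set.eq_of_subset_of_ncard_le (Set.subset_univ _) ?_ (Set.toFinite _)
    rw [hg.ncard_range, hρσ, Set.ncard_univ, Nat.card_fin]
  have hcopy : CopyOff π σ a b := by
    refine ⟨f, hf, ?_⟩
    ext x
    simp only [Set.mem_compl_iff, Set.mem_insert_iff, Set.mem_singleton_iff, not_or]
    constructor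
    · intro hx
      exact ⟨by rintro rfl; exact ha hx, by rintro rfl; exact hb hx⟩
    · rintro ⟨hxa, hxb⟩
      have : x ∈ insert a (insert b (Set.range f)) := huniv ▸ Set.mem_univ x
      exact (this.resolve_left hxa).resolve_left hxb
  obtain ⟨t, m, hm, rfl, rfl⟩ := exceptional_of_critical hσ (by omega) hπ
    (fun i h h' => hno i h' h) hab hcopy
  exact ⟨t, m, hm, rfl, hβπ, f, hf⟩

end Critical

end Permutation

/-! ### Folds, small simple permutations and types -/

/-- Each pass only adds elements, by a rule independent of the accumulator, so order and repetition
do not matter. Both nested loops of the algorithm are instances. -/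
theorem List.mem_foldl_of_step {α β : Type*} {g : List β → α → List β} {R : α → β → Prop}
    (hg : ∀ acc a x, x ∈ g acc a ↔ x ∈ acc ∨ R a x) (l : List α) (acc : List β) (x : β) :
    x ∈ l.foldl g acc ↔ x ∈ acc ∨ ∃ a ∈ l, R a x := by
  induction l generalizing acc with
  | nil => simp
  | cons a l ih => simp [ih, hg, or_assoc]

namespace Permutation

theorem mem_Av_of_isPatternOf {B : Set Permutation} {π σ : Permutation} (h : π.IsPatternOf σ)
    (hσ : σ ∈ Av B) : π ∈ Av B := fun β hβ hp => hσ β hβ (hp.trans h)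

theorem IsSimple.four_le {σ : Permutation} (h : σ.IsSimple) (h3 : 3 ≤ σ.size) : 4 ≤ σ.size := by
  rcases h.p2413_or_p3142 h3 with h | h <;> exact h.size_le

theorem eq_p1_of_size {σ : Permutation} (h : σ.size = 1) : σ = p1 := by
  obtain ⟨n, s⟩ := σ
  obtain rfl : n = 1 := h
  exact congrArg (Sigma.mk 1) (Subsingleton.elim _ _)

theorem eq_p12_or_p21_of_size {σ : Permutation} (h : σ.size = 2) : σ = p12 ∨ σ = p21 := by
  obtain ⟨n, s⟩ := σ
  obtain rfl : n = 2 := h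
  have : ∀ s : Equiv.Perm (Fin 2), s = Equiv.refl _ ∨ s = Equiv.swap 0 1 := by decide
  exact (this s).imp (congrArg (Sigma.mk 2)) (congrArg (Sigma.mk 2))

theorem isSimple_of_size_le_two {σ : Permutation} (h : 0 < σ.size) (h' : σ.size ≤ 2) :
    σ.IsSimple := by
  refine ⟨h, fun i j hij _ => ?_⟩
  by_cases hlt : i = j
  · exact Or.inl hlt
  · right
    ext z
    simp only [Finset.mem_Icc, Finset.mem_univ, iff_true]
    omega

theorem isSimple_p2413 : p2413.IsSimple := by
  have : p2413 = exceptional .one 2 := congrArg (Sigma.mk 4) (by decide)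
  exact this ▸ isSimple_exceptional le_rfl .one

theorem isSimple_p3142 : p3142.IsSimple := by
  have : p3142 = exceptional .three 2 := congrArg (Sigma.mk 4) (by decide)
  exact this ▸ isSimple_exceptional le_rfl .three

/-- From size 6 on, the first two letters determine the type. At size 4 types 1 and 4 both give
2413, and types 2 and 3 both give 3142. -/
theorem exceptional_injective_type {m : ℕ} (hm : 3 ≤ m) {t t' : ExcType}
    (h : exceptional t m = exceptional t' m) : t = t' := by
  have he : (exceptional t m).2 = (exceptional t' m).2 := eq_of_heq (Sigma.mk.inj h).2
  have e0 := congrArg (fun s : Equiv.Perm (Fin (2 * m)) => (s ⟨0, by omega⟩).1) he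
  have e1 := congrArg (fun s : Equiv.Perm (Fin (2 * m)) => (s ⟨1, by omega⟩).1) he
  cases t <;> cases t' <;> first
    | rfl
    | (exfalso
       simp [exceptional] at e0 e1
       split_ifs at e0 e1 <;> omega)
    | (exfalso
       simp [exceptional] at e0 e1
       omega)

/-- Every simple permutation of size at least five either has a simple one-point deletion or is
exceptional. -/
theorem IsSimple.deletePoint_or_exceptional {σ : Permutation} (hσ : σ.IsSimple) (hn : 5 ≤ σ.size) :
    (∃ i, (σ.deletePoint i).IsSimple) ∨
      ∃ t m, 2 ≤ m ∧ σ = exceptional t (m + 1) ∧ (exceptional t m).IsPatternOf σ := by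
  rcases hσ.p2413_or_p3142 (by omega) with h | h
  · rcases simple_pattern_cases hσ isSimple_p2413 le_rfl h hn with ⟨i, hi, -⟩ | ⟨t, m, h1, h2, -, h3⟩
    · exact Or.inl ⟨i, hi⟩
    · exact Or.inr ⟨t, m, h1, h2, h3⟩
  · rcases simple_pattern_cases hσ isSimple_p3142 le_rfl h hn with ⟨i, hi, -⟩ | ⟨t, m, h1, h2, -, h3⟩
    · exact Or.inl ⟨i, hi⟩
    · exact Or.inr ⟨t, m, h1, h2, h3⟩

theorem isPatternOf_insertPoint (π : Permutation) (i a : Fin (π.size + 1)) :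
    π.IsPatternOf (π.insertPoint i a) := by
  have key : ∀ j, (π.insertPoint i a).2 (i.succAbove j) = a.succAbove (π.2 j) := by
    intro j
    change (finSuccEquiv' a).symm (Equiv.optionCongr π.2 (finSuccEquiv' i (i.succAbove j))) = _
    simp
  refine ⟨i.succAbove, i.strictMono_succAbove, fun j k => ?_⟩
  rw [key, key]
  exact (a.strictMono_succAbove.lt_iff_lt).symm

end Permutation

/-! ### Correctness and termination of the algorithm -/

namespace SimpleGen

open Permutation

variable {B : Finset Permutation}

theorem mem_simpleInsertions {π σ : Permutation} :
    σ ∈ simpleInsertions π ↔ σ.IsSimple ∧ ∃ i a, π.insertPoint i a = σ := by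
  simp [simpleInsertions, and_comm]

theorem deletionTest_eq_true {prev : List Permutation} {σ : Permutation} :
    deletionTest prev σ = true ↔ ∀ i, (σ.deletePoint i).IsSimple → σ.deletePoint i ∈ prev := by
  -- The initial flag is generalized for the induction: once false, it stays false.
  have key : ∀ (l : List (Fin σ.size)) (b : Bool), l.foldl
      (fun inS i =>
        let τ := σ.deletePoint i
        if τ.IsSimple then (if τ ∉ prev then false else inS) else inS) b = true ↔
        b = true ∧ ∀ i ∈ l, (σ.deletePoint i).IsSimple → σ.deletePoint i ∈ prev := by
    intro l
    induction l with
    | nil => simp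
    | cons i l ih =>
      intro b
      rw [List.foldl_cons, ih]
      by_cases h1 : (σ.deletePoint i).IsSimple <;> by_cases h2 : σ.deletePoint i ∈ prev <;>
        simp [h1, h2]
  rw [deletionTest, key]
  simp

theorem mem_insertionLoop {prev acc : List Permutation} {σ : Permutation} :
    σ ∈ insertionLoop B prev acc ↔ σ ∈ acc ∨ ∃ π ∈ prev, ∃ ρ ∈ simpleInsertions π,
      ρ ∉ B ∧ deletionTest prev ρ = true ∧ σ = ρ := by
  refine List.mem_foldl_of_step (R := fun π σ => ∃ ρ ∈ simpleInsertions π,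
      ρ ∉ B ∧ deletionTest prev ρ = true ∧ σ = ρ) (fun acc π x => ?_) prev acc σ
  refine List.mem_foldl_of_step (R := fun ρ σ =>
      ρ ∉ B ∧ deletionTest prev ρ = true ∧ σ = ρ) (fun acc ρ x => ?_) _ acc x
  split_ifs with h1 h2
  · tauto
  · rw [List.mem_insert_iff]
    tauto
  · tauto

theorem mem_exceptionalLoop {prev acc : List Permutation} {σ : Permutation} :
    σ ∈ exceptionalLoop B prev acc ↔ σ ∈ acc ∨ ∃ π ∈ prev,
      ∃ t ∈ [ExcType.one, ExcType.two, ExcType.three, ExcType.four],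
        (2 ≤ π.size / 2 ∧ π = exceptional t (π.size / 2)) ∧
          exceptional t (π.size / 2 + 1) ∉ B ∧ σ = exceptional t (π.size / 2 + 1) := by
  refine List.mem_foldl_of_step (R := fun π σ =>
      ∃ t ∈ [ExcType.one, ExcType.two, ExcType.three, ExcType.four],
        (2 ≤ π.size / 2 ∧ π = exceptional t (π.size / 2)) ∧
          exceptional t (π.size / 2 + 1) ∉ B ∧ σ = exceptional t (π.size / 2 + 1))
      (fun acc π x => ?_) prev acc σ
  refine List.mem_foldl_of_step (R := fun t σ =>
        (2 ≤ π.size / 2 ∧ π = exceptional t (π.size / 2)) ∧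
          exceptional t (π.size / 2 + 1) ∉ B ∧ σ = exceptional t (π.size / 2 + 1))
      (fun acc t x => ?_) _ acc x
  simp only
  split_ifs with h1 h2
  · tauto
  · rw [List.mem_insert_iff]
    tauto
  · tauto

/-- The list `l` consists of the simple permutations of size `j` in `Av B`. -/
def IsLevel (B : Finset Permutation) (j : ℕ) (l : List Permutation) : Prop :=
  ∀ σ : Permutation, σ ∈ l ↔ σ.size = j ∧ σ.IsSimple ∧ σ ∈ Av (B : Set Permutation)

/-- There is no simple permutation of size 3. The bound is what `simple_pattern_cases` needs for
forbidden patterns. -/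
theorem four_le_of_mem (hsimple : ∀ β ∈ B, β.IsSimple) (h1 : p1 ∉ B) (h12 : p12 ∉ B) (h21 : p21 ∉ B)
    {β : Permutation} (hβ : β ∈ B) : 4 ≤ β.size := by
  have hs := hsimple β hβ
  refine hs.four_le ?_
  by_contra! hlt
  have hpos := hs.1
  rcases (show β.size = 1 ∨ β.size = 2 by omega) with h | h
  · exact h1 (eq_p1_of_size h ▸ hβ)
  · rcases eq_p12_or_p21_of_size h with h | h
    · exact h12 (h ▸ hβ)
    · exact h21 (h ▸ hβ)

theorem isLevel_init (h4 : ∀ β ∈ B, 4 ≤ β.size) {j : ℕ} (hj : j < 5) :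
    IsLevel B j ((init B).Si j) := by
  have hsmall : ∀ σ : Permutation, σ.size < 4 → σ ∈ Av (B : Set Permutation) := by
    intro σ hσ β hβ hp
    have := h4 β hβ
    have := hp.size_le
    omega
  have h2413 : p2413.size = 4 := rfl
  have h3142 : p3142.size = 4 := rfl
  intro σ
  obtain rfl | rfl | rfl | rfl | rfl : j = 0 ∨ j = 1 ∨ j = 2 ∨ j = 3 ∨ j = 4 := by omega
  · simp only [init]
    norm_num
    intro h hs
    have := hs.1
    omega
  · simp only [init, if_true, List.mem_singleton]
    constructor
    · rintro rfl
      exact ⟨rfl, isSimple_of_size_le_two (by decide) (by decide), hsmall _ (by decide)⟩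
    · exact fun h => eq_p1_of_size h.1
  · simp only [init, if_true, List.mem_cons, List.not_mem_nil, or_false, OfNat.ofNat_ne_one, if_false]
    constructor
    · rintro (rfl | rfl) <;>
        exact ⟨rfl, isSimple_of_size_le_two (by decide) (by decide), hsmall _ (by decide)⟩
    · exact fun h => eq_p12_or_p21_of_size h.1
  · simp only [init]
    norm_num
    intro h hs
    have := hs.four_le (by omega)
    omega
  · have : (init B).Si 4 = [p2413, p3142].filter (fun σ => σ ∉ B) := rfl
    rw [this, List.mem_filter, decide_eq_true_iff]
    constructor
    · rintro ⟨hσ, hB⟩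
      have hσ : σ = p2413 ∨ σ = p3142 := by simpa using hσ
      have hsize : σ.size = 4 := by rcases hσ with rfl | rfl <;> rfl
      refine ⟨hsize, ?_, fun β hβ hp => ?_⟩
      · rcases hσ with rfl | rfl
        · exact isSimple_p2413
        · exact isSimple_p3142
      · have h1 := hp.eq_of_size_eq (le_antisymm hp.size_le (hsize ▸ h4 β hβ))
        exact hB (h1 ▸ hβ)
    · rintro ⟨hsize, hs, hAv⟩
      refine ⟨?_, fun hB => hAv σ hB (IsPatternOf.refl σ)⟩
      rcases hs.p2413_or_p3142 (by omega) with h | h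
      · simp [← h.eq_of_size_eq (by omega)]
      · simp [← h.eq_of_size_eq (by omega)]

/-- One iteration computes the next level. -/
theorem isLevel_step (hsimple : ∀ β ∈ B, β.IsSimple) (h4 : ∀ β ∈ B, 4 ≤ β.size) {n : ℕ} (hn : 5 ≤ n)
    {l₁ l₂ : List Permutation} (hl₁ : IsLevel B (n - 1) l₁) (hl₂ : IsLevel B (n - 2) l₂) :
    IsLevel B n (exceptionalLoop B l₂ (insertionLoop B l₁ [])) := by
  intro σ
  rw [mem_exceptionalLoop, mem_insertionLoop]
  constructor
  · rintro ((h | ⟨π, hπ, ρ, hρ, hB, htest, rfl⟩) | ⟨π, hπ, t, -, ⟨hm, hπt⟩, hB, rfl⟩)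
    · simp at h
    · obtain ⟨hs, i, a, hia⟩ := mem_simpleInsertions.1 hρ
      obtain ⟨hπn, hπs, hπA⟩ := (hl₁ π).1 hπ
      have hsize : σ.size = n := by
        rw [← hia]
        change π.size + 1 = n
        omega
      have hpat : π.IsPatternOf σ := hia ▸ isPatternOf_insertPoint π i a
      refine ⟨hsize, hs, fun β hβ hp => ?_⟩
      have hlt := hp.size_lt (fun h => hB (h ▸ hβ))
      -- A forbidden pattern would lie in a simple deletion that passed the test. The exceptional
      -- case cannot occur, since `σ` has the simple deletion `π`.
      rcases simple_pattern_cases hs (hsimple β hβ) (h4 β hβ) hp hlt with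
        ⟨i, h1, h2⟩ | ⟨t, m, hm, rfl, -⟩
      · exact ((hl₁ _).1 (deletionTest_eq_true.1 htest i h1)).2.2 β hβ h2
      · obtain ⟨j, hj⟩ := hpat.exists_eq_deletePoint (by omega)
        exact not_isSimple_deletePoint_exceptional (by omega) t j (hj ▸ hπs)
    · obtain ⟨hπn, hπs, hπA⟩ := (hl₂ π).1 hπ
      set m := π.size / 2 with hmdef
      have hπm : π.size = 2 * m := congrArg size hπt
      have hsize : (exceptional t (m + 1)).size = 2 * (m + 1) := rfl
      have hs := isSimple_exceptional (m := m + 1) (by omega) t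
      refine ⟨by omega, hs, fun β hβ hp => ?_⟩
      have hlt := hp.size_lt (fun h => hB (h ▸ hβ))
      -- No one-point deletion is simple here, so a forbidden pattern would already lie in `π`.
      rcases simple_pattern_cases hs (hsimple β hβ) (h4 β hβ) hp hlt with
        ⟨i, h1, -⟩ | ⟨t', m', hm', heq, h2, -⟩
      · exact not_isSimple_deletePoint_exceptional (by omega) t i h1
      · obtain rfl : m = m' := by
          have := congrArg size heq
          change 2 * (m + 1) = 2 * (m' + 1) at this
          omega
        obtain rfl := exceptional_injective_type (by omega) heq
        exact hπA β hβ (hπt ▸ h2)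
  · rintro ⟨hsize, hs, hA⟩
    have hB : σ ∉ B := fun h => hA σ h (IsPatternOf.refl σ)
    rcases hs.deletePoint_or_exceptional (by omega) with ⟨i, hi⟩ | ⟨t, m, hm, rfl, hp⟩
    · left
      right
      have key : ∀ i, (σ.deletePoint i).IsSimple → σ.deletePoint i ∈ l₁ := fun i hi =>
        (hl₁ _).2 ⟨by have := deletePoint_size σ i; omega, hi,
          mem_Av_of_isPatternOf (deletePoint_isPatternOf σ i) hA⟩
      exact ⟨_, key i hi, σ, mem_simpleInsertions.2 ⟨hs, exists_insertPoint_deletePoint σ i⟩, hB,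
        deletionTest_eq_true.2 key, rfl⟩
    · right
      have h1 : (exceptional t (m + 1)).size = 2 * (m + 1) := rfl
      have h2 : (exceptional t m).size = 2 * m := rfl
      have h3 : (exceptional t m).size / 2 = m := by omega
      refine ⟨exceptional t m, (hl₂ _).2 ⟨by omega, isSimple_exceptional hm t,
        mem_Av_of_isPatternOf hp hA⟩, t, by cases t <;> simp, ?_, ?_, ?_⟩
      · rw [h3]
        exact ⟨hm, rfl⟩
      · rw [h3]
        exact hB
      · rw [h3]

/-- The loop invariant. -/
def Invariant (B : Finset Permutation) (s : State) : Prop :=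
  5 ≤ s.n ∧ ∀ j < s.n, IsLevel B j (s.Si j)

theorem Invariant.body (hsimple : ∀ β ∈ B, β.IsSimple) (h4 : ∀ β ∈ B, 4 ≤ β.size) {s : State}
    (h : Invariant B s) : Invariant B (body B s) := by
  obtain ⟨hn, h⟩ := h
  refine ⟨by change 5 ≤ s.n + 1; omega, fun j hj => ?_⟩
  change j < s.n + 1 at hj
  change IsLevel B j (Function.update s.Si s.n _ j)
  by_cases hjn : j = s.n
  · subst hjn
    rw [Function.update_self]
    exact isLevel_step hsimple h4 hn (h _ (by omega)) (h _ (by omega))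
  · rw [Function.update_of_ne hjn]
    exact h j (by omega)

theorem Invariant.whileExec (hsimple : ∀ β ∈ B, β.IsSimple) (h4 : ∀ β ∈ B, 4 ≤ β.size) {s t : State}
    (hs : Invariant B s) (h : WhileExec guard (SimpleGen.body B) s t) :
    Invariant B t ∧ ¬ guard t := by
  induction h with
  | stop_now s hg => exact ⟨hs, hg⟩
  | iterate s t _ _ ih => exact ih (hs.body hsimple h4)

/-- When the loop stops, there are no further simple permutations. -/
theorem Invariant.size_lt {s : State} (hs : Invariant B s) (hg : ¬ guard s) (σ : Permutation)
    (hσ : σ.IsSimple) (hA : σ ∈ Av (B : Set Permutation)) : σ.size < s.n := by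
  by_contra! hge
  obtain ⟨hn, h⟩ := hs
  unfold guard at hg
  push Not at hg
  -- Steps down have length one or two, so a descent from size at least `s.n` cannot jump over both
  -- empty levels `s.n - 1` and `s.n - 2`.
  have main : ∀ k, ∀ σ : Permutation, σ.size = k → s.n - 2 ≤ σ.size → σ.IsSimple →
      σ ∉ Av (B : Set Permutation) := by
    intro k
    induction k using Nat.strong_induction_on with
    | _ k ih =>
      intro σ hk hle hσ hA
      rcases Nat.lt_or_ge σ.size s.n with hlt | hge
      · have hmem := (h σ.size hlt σ).2 ⟨rfl, hσ, hA⟩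
        rcases (show σ.size = s.n - 1 ∨ σ.size = s.n - 2 by omega) with he | he
        · rw [he, hg.1] at hmem
          simp at hmem
        · rw [he, hg.2] at hmem
          simp at hmem
      · rcases hσ.deletePoint_or_exceptional (by omega) with ⟨i, hi⟩ | ⟨t, m, hm, rfl, hp⟩
        · have := deletePoint_size σ i
          exact ih _ (by omega) (σ.deletePoint i) rfl (by omega) hi
            (mem_Av_of_isPatternOf (deletePoint_isPatternOf σ i) hA)
        · have h1 : (exceptional t (m + 1)).size = 2 * (m + 1) := rfl
          have h2 : (exceptional t m).size = 2 * m := rfl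
          exact ih _ (by omega) (exceptional t m) rfl (by omega) (isSimple_exceptional hm t)
            (mem_Av_of_isPatternOf hp hA)
  exact main _ σ rfl (by omega) hσ hA

/-- `k` bounds the remaining iterations: once `s.n` reaches `N + 2`, both levels in the guard have
index at least `N` and are empty. -/
theorem Invariant.exists_whileExec (hsimple : ∀ β ∈ B, β.IsSimple) (h4 : ∀ β ∈ B, 4 ≤ β.size)
    {N : ℕ} (hN : ∀ σ : Permutation, σ.IsSimple → σ ∈ Av (B : Set Permutation) → σ.size < N)
    (k : ℕ) : ∀ s, Invariant B s → N + 2 ≤ s.n + k → ∃ t, WhileExec guard (SimpleGen.body B) s t := by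
  induction k with
  | zero =>
    intro s hs hk
    refine ⟨s, .stop_now s ?_⟩
    have hempty : ∀ j, N ≤ j → j < s.n → s.Si j = [] := by
      intro j hj hjn
      refine List.eq_nil_iff_forall_not_mem.2 fun σ hσ => ?_
      obtain ⟨h1, h2, h3⟩ := (hs.2 j hjn σ).1 hσ
      have := hN σ h2 h3
      omega
    have h5 := hs.1
    rintro (h | h)
    · exact h (hempty _ (by omega) (by omega))
    · exact h (hempty _ (by omega) (by omega))
  | succ k ih =>
    intro s hs hk
    by_cases hg : guard s
    · obtain ⟨t, ht⟩ := ih (SimpleGen.body B s) (hs.body hsimple h4)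
        (by change N + 2 ≤ s.n + 1 + k; omega)
      exact ⟨t, .iterate s t hg ht⟩
    · exact ⟨s, .stop_now s hg⟩

theorem Invariant.mem_result {s : State} (hs : Invariant B s) (hg : ¬ guard s) (σ : Permutation) :
    σ ∈ result s ↔ σ.IsSimple ∧ σ ∈ Av (B : Set Permutation) := by
  rw [result, List.mem_flatMap]
  constructor
  · rintro ⟨j, hj, hσ⟩
    exact ((hs.2 j (List.mem_range.1 hj) σ).1 hσ).2
  · rintro ⟨h1, h2⟩
    have hlt := hs.size_lt hg σ h1 h2
    exact ⟨σ.size, List.mem_range.2 hlt, (hs.2 _ hlt σ).2 ⟨rfl, h1, h2⟩⟩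

end SimpleGen

theorem mainTheorem11 (B : Finset Permutation)
    (hsimple : ∀ β ∈ B, β.IsSimple)
    (h1 : Permutation.p1 ∉ B) (h12 : Permutation.p12 ∉ B) (h21 : Permutation.p21 ∉ B) :
    (SimpleGen.Terminates B ↔
      {σ : Permutation | σ.IsSimple ∧ σ ∈ Permutation.Av (B : Set Permutation)}.Finite) ∧
    ∀ out : List Permutation, SimpleGen.Returns B out →
      ∀ σ : Permutation, σ ∈ out ↔ σ.IsSimple ∧ σ ∈ Permutation.Av (B : Set Permutation) := by
  have h4 : ∀ β ∈ B, 4 ≤ β.size := fun β hβ => SimpleGen.four_le_of_mem hsimple h1 h12 h21 hβ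
  have hinit : SimpleGen.Invariant B (SimpleGen.init B) :=
    ⟨le_rfl, fun j hj => SimpleGen.isLevel_init h4 hj⟩
  have hout : ∀ out : List Permutation, SimpleGen.Returns B out →
      ∀ σ : Permutation, σ ∈ out ↔ σ.IsSimple ∧ σ ∈ Permutation.Av (B : Set Permutation) := by
    rintro out ⟨t, ht, rfl⟩ σ
    obtain ⟨hs, hg⟩ := hinit.whileExec hsimple h4 ht
    exact hs.mem_result hg σ
  refine ⟨⟨?_, fun hfin => ?_⟩, hout⟩
  · rintro ⟨out, h⟩
    refine (List.finite_toSet out).subset fun σ hσ => (hout out h σ).2 hσ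
  · obtain ⟨N, hN⟩ := (hfin.image Permutation.size).bddAbove
    obtain ⟨t, ht⟩ := hinit.exists_whileExec hsimple h4 (N := N + 1)
      (fun σ h1 h2 => Nat.lt_succ_of_le (hN ⟨σ, ⟨h1, h2⟩, rfl⟩)) (N + 3) _
      (by change N + 1 + 2 ≤ 5 + (N + 3); omega)
    exact ⟨_, t, ht, rfl⟩
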